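/- Let $\mathcal M_n$ be the space of complex $n\times n$ matrices, let $\Omega_n=\{A\in\mathcal M_n : r(A)<1\}$ be the spectral ball ($r$ is the spectral radius), and let $\mathcal C_n$ be the set of cyclic matrices in $\Omega_n$, i.e. of those $A\in\Omega_n$ for which there is $v\in\mathbb C^n$ with $\mathbb C^n=\operatorname{span}(v,Av,\dots,A^{n-1}v)$. Let $\sigma=(\sigma_1,\dots,\sigma_n):\mathcal M_n\to\mathbb C^n$, where $\sigma_j(A)$ is the $j$-th elementary symmetric function of the eigenvalues of $A$ (with multiplicity), and let $\sigma'_A$ be its Fréchet derivative at $A$. Let $\mathbb D$ be the open unit disc and let $\mathcal O(X,Y)$ be the set of holomorphic maps from $X$ to $Y$. For $f\in\mathcal O(\Omega_n,\mathbb D)$ let $f_A^*$ be the homogeneous polynomial of lowest nonzero degree in the expansion of $f$ at $A$ (with $f_A^*=0$ if $f$ is constant), and put $$C'_A=\{B\in\mathcal M_n : f_A^*(B)=0\ \text{ for every } f\in\mathcal O(\Omega_n,\mathbb D)\}.$$ Let $$\kappa_{\Omega_n}(A;B)=\inf\{|\alpha| : \alpha\in\mathbb C,\ \exists\,\varphi\in\mathcal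 O(\mathbb D,\Omega_n),\ \varphi(0)=A,\ \alpha\varphi'(0)=B\}$$ be the Kobayashi metric of $\Omega_n$. Say that the spectral Carathéodory–Fejér problem (of order one) with data $(A,B)\in\Omega_n\times\mathcal M_n$ is solvable if there is $F\in\mathcal O(\mathbb D,\Omega_n)$ with $F(0)=A$ and $F'(0)=B$. Let $A\in\Omega_n\setminus\mathcal C_n$. Then $C'_A\subsetneq\ker\sigma'_A$. Moreover, $A$ lies in the closure of $\mathcal C_n$, and for every $B\in\ker\sigma'_A\setminus C'_A$, $$\kappa_{\Omega_n}(A;B)>0=\lim_{\mathcal C_n\ni A'\to A}\kappa_{\Omega_n}(A';B).$$ Hence $\kappa_{\Omega_n}(\cdot\,;B)$ is not continuous at $A$, and the spectral Carathéodory–Fejér problem does not depend continuously on the data: if $t$ is a real number with $t\,\kappa_{\Omega_n}(A;B)>1$, then the problem is not solvable for the data $(A,tB)$, but it is solvable for the data $(A',tB)$ for all $A'\in\mathcal C_n$ sufficiently close to $A$. -/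

import Mathlib

open Set Filter Topology

noncomputable section

namespace SpectralBall

/-- The space `𝓜_n` of complex `n × n` matrices. -/
abbrev Mat (n : ℕ) : Type := Matrix (Fin n) (Fin n) ℂ

/-- The spectral ball `Ω_n`: matrices of spectral radius less than one. -/
def Omega (n : ℕ) : Set (Mat n) := {A | spectralRadius ℂ A < 1}

/-- A matrix is cyclic if it has a cyclic vector: `ℂⁿ = span (v, A v, …, A^(n-1) v)`. -/
def IsCyclicMat {n : ℕ} (A : Mat n) : Prop :=
  ∃ v : Fin n → ℂ,
    Submodule.span ℂ (Set.range fun k : Fin n => (A ^ (k : ℕ)).mulVec v) = ⊤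

/-- The set `𝓒_n` of cyclic matrices in the spectral ball. -/
def cyclicSet (n : ℕ) : Set (Mat n) := {A | A ∈ Omega n ∧ IsCyclicMat A}

/-- The map `σ = (σ_1, …, σ_n)`: elementary symmetric functions of the eigenvalues of a matrix,
counted with algebraic multiplicity. The component with index `k : Fin n` is `σ_(k+1)`. -/
def sigma (n : ℕ) (A : Mat n) : Fin n → ℂ :=
  fun k => A.charpoly.roots.esymm ((k : ℕ) + 1)

/-- The kernel of the complex Fréchet derivative `σ'_A`. -/
def kerSigma' {n : ℕ} (A : Mat n) : Set (Mat n) := {B | fderiv ℂ (sigma n) A B = 0}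

section General

variable {E : Type*} [AddCommGroup E] [Module ℂ E] [TopologicalSpace E]

/-- `f ∈ 𝓞(𝔻, D)`: `f` is a holomorphic map from the open unit disc into `D`. -/
def IsHolDisc (D : Set E) (f : ℂ → E) : Prop :=
  DifferentiableOn ℂ f (Metric.ball 0 1) ∧ MapsTo f (Metric.ball 0 1) D

/-- The Kobayashi (Kobayashi--Royden) metric
`κ_D(a; X) = inf {|α| : ∃ φ ∈ 𝓞(𝔻, D), φ(0) = a, α φ'(0) = X}`. -/
def kobayashi (D : Set E) (a X : E) : ℝ :=
  sInf {r : ℝ | ∃ (α : ℂ) (φ : ℂ → E),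
    IsHolDisc D φ ∧ φ 0 = a ∧ α • deriv φ 0 = X ∧ r = ‖α‖}

/-- The homogeneous part of degree `k` in the expansion of a holomorphic function `g` at `a`,
evaluated at `X`: the coefficient of `t ^ k` in the expansion of `g (a + t X)` at `t = 0`. -/
def homPart (g : E → ℂ) (a : E) (k : ℕ) (X : E) : ℂ :=
  iteratedDeriv k (fun t : ℂ => g (a + t • X)) 0 / (k.factorial : ℂ)

open Classical in
/-- `g_a^*`: the homogeneous polynomial of lowest nonzero degree in the expansion of `g` at `a`
(it is zero if `g` is constant near `a`). -/
def lowestTerm (g : E → ℂ) (a : E) (X : E) : ℂ :=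
  if h : ∃ k : ℕ, 1 ≤ k ∧ homPart g a k ≠ 0 then homPart g a (Nat.find h) X else 0

end General

/-- The cone `C'_A`: common zeros of the lowest-order terms `f_A^*` of all `f ∈ 𝓞(Ω_n, 𝔻)`. -/
def coneC' {n : ℕ} (A : Mat n) : Set (Mat n) :=
  {B | ∀ f : Mat n → ℂ, DifferentiableOn ℂ f (Omega n) →
    MapsTo f (Omega n) (Metric.ball 0 1) → lowestTerm f A B = 0}

/-- The spectral Carathéodory--Fejér problem of order one with data `(A, B)` is solvable:
there is `F ∈ 𝓞(𝔻, Ω_n)` with `F(0) = A` and `F'(0) = B`. -/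
def SCFPSolvable {n : ℕ} (A B : Mat n) : Prop :=
  ∃ F : ℂ → Mat n, IsHolDisc (Omega n) F ∧ F 0 = A ∧ deriv F 0 = B

end SpectralBall

end

open Set Filter Topology
open scoped Matrix

namespace SpectralBall

/-! ### Lower bounds for the Kobayashi metric from lowest-order terms -/

section General

open Metric

variable {E : Type*} [NormedAddCommGroup E] [NormedSpace ℂ E]

/-! The kernel of `σ'_A` is the trace-orthogonal complement of the algebra `ℂ[A]`
(`mem_kerSigma'_iff`); the three claims compare this space at cyclic and at noncyclic points.

Near `A`, solvability: the centralizer of a cyclic `A'` is `ℂ[A']`, so by duality `ker σ'_{A'}`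
consists of commutators with `A'`. Conjugation by `exp (ζ Y)` realises such a direction without
moving the spectrum, so solving at `A'` only requires a disc of characteristic polynomials
(`scfpSolvable_of_isCyclicMat`). If `T ∈ ker σ'_A`, its image under `σ'_{A'}` is small for `A'` near
`A`, and an affine disc suffices (`eventually_scfpSolvable`). Applied to large multiples of `B`,
this sends `κ(A'; B)` to zero.

At `A`, obstruction: if `f` has lowest-order term of degree `k` at `A`, the Schwarz lemma of order
`k` along discs gives `|f_A^*(B)| ≤ 2 |α|^k`, whence `κ(A; B) > 0` off the cone (`kobayashi_pos`).

Strict inclusion: a noncyclic `A` has an eigenvalue `x` for which `N = x - A` has corank `m ≥ 2`.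
The lowest term of `det (x - ·)` at `A` has degree `m` and is, up to a nonzero factor, the
determinant of an `m × m` block of the direction. Membership in `ker σ'_A` restricts this block by
at most one linear condition, since the elements of `ℂ[A]` killed by `N` form a space of dimension
at most one; as `m ≥ 2`, an invertible block meets it (`exists_direction`). -/

/-- If the derivatives of orders `1, …, n` of `g` vanish at `0`, then `(g s - g 0) / s ^ (n + 1)`
tends to the next Taylor coefficient. -/
theorem tendsto_sub_div_pow_of_iteratedDeriv_eq_zero {g : ℂ → ℂ} (hg : AnalyticAt ℂ g 0) {n : ℕ}
    (h : ∀ j, 1 ≤ j → j ≤ n → iteratedDeriv j g 0 = 0) :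
    Tendsto (fun s => (g s - g 0) / s ^ (n + 1)) (𝓝[≠] 0)
      (𝓝 (iteratedDeriv (n + 1) g 0 / ((n + 1).factorial : ℂ))) := by
  obtain ⟨F, hF, hgF⟩ := hg.exists_eventuallyEq_sum_add_pow_mul (n + 2)
  have key : ∀ᶠ s in 𝓝[≠] (0 : ℂ),
      iteratedDeriv (n + 1) g 0 / ((n + 1).factorial : ℂ) + s * F s =
        (g s - g 0) / s ^ (n + 1) := by
    filter_upwards [nhdsWithin_le_nhds hgF, self_mem_nhdsWithin] with s hs hs0
    have hs0 : s ≠ 0 := hs0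
    rw [hs, Finset.sum_range_succ, Finset.sum_range_succ', Finset.sum_eq_zero]
    · simp only [pow_zero, Nat.factorial_zero, Nat.cast_one, div_one, iteratedDeriv_zero,
        smul_eq_mul]
      have : ((n + 1).factorial : ℂ) ≠ 0 := by exact_mod_cast Nat.factorial_ne_zero _
      field_simp
      ring
    · intro j hj
      rw [h (j + 1) (by omega) (by have := Finset.mem_range.1 hj; omega), smul_zero]
  refine Tendsto.congr' key ?_
  have : Tendsto (fun s => iteratedDeriv (n + 1) g 0 / ((n + 1).factorial : ℂ) + s * F s) (𝓝 0)
      (𝓝 (iteratedDeriv (n + 1) g 0 / ((n + 1).factorial : ℂ) + 0 * F 0)) :=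
    tendsto_const_nhds.add (tendsto_id.mul hF.continuousAt)
  rw [zero_mul, add_zero] at this
  exact this.mono_left nhdsWithin_le_nhds

/-- Order of vanishing from boundedness of the difference quotient off the centre. -/
theorem isLittleO_pow_of_norm_le {g : ℂ → ℂ} {C : ℝ} {n : ℕ}
    (h : ∀ᶠ s in 𝓝 (0 : ℂ), ‖g s - g 0‖ ≤ C * ‖s‖ ^ (n + 1)) :
    (g · - g 0) =o[𝓝 0] (fun s : ℂ => ‖s - 0‖ ^ n) := by
  have h1 : (g · - g 0) =O[𝓝 0] (fun s : ℂ => ‖s‖ ^ (n + 1)) :=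
    Asymptotics.IsBigO.of_bound C (by simpa using h)
  refine h1.trans_isLittleO ?_
  simp only [sub_zero]
  exact ((Asymptotics.isLittleO_pow_pow (𝕜 := ℝ) n.lt_succ_self).comp_tendsto
    (tendsto_norm_zero (E := ℂ)))

theorem eventually_norm_sub_le_of_iteratedDeriv_eq_zero {g : ℂ → ℂ} (hg : AnalyticAt ℂ g 0) {n : ℕ}
    (h : ∀ j, 1 ≤ j → j ≤ n → iteratedDeriv j g 0 = 0) :
    ∃ C, ∀ᶠ s in 𝓝 (0 : ℂ), ‖g s - g 0‖ ≤ C * ‖s‖ ^ (n + 1) := by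
  have := (tendsto_sub_div_pow_of_iteratedDeriv_eq_zero hg h).norm
  obtain ⟨C, hC⟩ := this.isBoundedUnder_le
  refine ⟨C, ?_⟩
  have hC : ∀ᶠ s in 𝓝[≠] (0 : ℂ), ‖(g s - g 0) / s ^ (n + 1)‖ ≤ C := hC
  rw [eventually_nhdsWithin_iff] at hC
  filter_upwards [hC] with s hs
  by_cases hs0 : s = 0
  · simp [hs0]
  · have := hs hs0
    rwa [norm_div, norm_pow, div_le_iff₀ (by positivity)] at this

/-- A holomorphic disc centred at an interior point exists in every direction. -/
theorem kobayashi_set_nonempty {D : Set E} (hD : IsOpen D) {a : E} (ha : a ∈ D) (X : E) :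
    {r : ℝ | ∃ (α : ℂ) (φ : ℂ → E),
      IsHolDisc D φ ∧ φ 0 = a ∧ α • deriv φ 0 = X ∧ r = ‖α‖}.Nonempty := by
  obtain ⟨δ, hδ, hball⟩ := Metric.isOpen_iff.1 hD a ha
  have hX : 0 < ‖X‖ + 1 := by positivity
  set ε : ℝ := δ / (‖X‖ + 1) with hε
  have hε0 : 0 < ε := by positivity
  refine ⟨_, ((ε : ℂ))⁻¹, fun ζ => a + ζ • ((ε : ℂ) • X), ⟨?_, ?_⟩, by simp, ?_, rfl⟩
  · exact Differentiable.differentiableOn (by fun_prop)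
  · intro ζ hζ
    apply hball
    rw [mem_ball_zero_iff] at hζ
    rw [mem_ball, dist_eq_norm, add_sub_cancel_left, norm_smul, norm_smul, Complex.norm_real,
      Real.norm_of_nonneg hε0.le]
    have h1 : ε * ‖X‖ < δ := by
      rw [hε, div_mul_eq_mul_div, div_lt_iff₀ hX]
      nlinarith
    calc ‖ζ‖ * (ε * ‖X‖) ≤ 1 * (ε * ‖X‖) := by gcongr
      _ < δ := by rwa [one_mul]
  · have : HasDerivAt (fun ζ : ℂ => a + ζ • ((ε : ℂ) • X)) ((1 : ℂ) • ((ε : ℂ) • X)) 0 :=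
      ((hasDerivAt_id (0 : ℂ)).smul_const _).const_add _
    rw [this.deriv, one_smul, inv_smul_smul₀]
    exact_mod_cast hε0.ne'

/-- The coefficient of lowest order of a bounded holomorphic function bounds the derivative of
every holomorphic disc from above. -/
theorem norm_homPart_le {D : Set E} (hD : IsOpen D) {a X : E} (ha : a ∈ D) {f : E → ℂ}
    (hf : DifferentiableOn ℂ f D) (hm : MapsTo f D (ball 0 1)) {n : ℕ}
    (h0 : ∀ j, 1 ≤ j → j ≤ n → homPart f a j = 0) {α : ℂ} {φ : ℂ → E} (hα : α ≠ 0)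
    (hφ : IsHolDisc D φ) (hφ0 : φ 0 = a) (hφ' : α • deriv φ 0 = X) :
    ‖homPart f a (n + 1) X‖ ≤ 2 * ‖α‖ ^ (n + 1) := by
  obtain ⟨δ, hδ, hball⟩ := Metric.isOpen_iff.1 hD a ha
  have hXpos : 0 < ‖X‖ + 1 := by positivity
  -- One radius serves all directions in the unit ball around `X`, so the estimates below are
  -- uniform in `Y`.
  set r : ℝ := δ / (‖X‖ + 1) with hr
  have hr0 : 0 < r := by positivity
  have hmem : ∀ Y ∈ ball X 1, ∀ s ∈ ball (0 : ℂ) r, a + s • Y ∈ D := by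
    intro Y hY s hs
    apply hball
    rw [mem_ball_iff_norm] at hY
    rw [mem_ball_zero_iff] at hs
    rw [mem_ball_iff_norm, add_sub_cancel_left, norm_smul]
    have hYn : ‖Y‖ < ‖X‖ + 1 := by
      have := norm_le_norm_add_norm_sub' Y X
      linarith
    calc ‖s‖ * ‖Y‖ ≤ ‖s‖ * (‖X‖ + 1) := by gcongr
      _ < r * (‖X‖ + 1) := by gcongr
      _ = δ := by rw [hr]; field_simp
  have hdist : ∀ p ∈ D, ∀ q ∈ D, f p ∈ closedBall (f q) 2 := by
    intro p hp q hq
    have h1 := mem_ball_zero_iff.1 (hm hp)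
    have h2 := mem_ball_zero_iff.1 (hm hq)
    rw [mem_closedBall, dist_eq_norm]
    have := norm_sub_le (f p) (f q)
    linarith
  have hgd : ∀ Y ∈ ball X 1, DifferentiableOn ℂ (fun s : ℂ => f (a + s • Y)) (ball 0 r) := by
    intro Y hY
    exact hf.comp (Differentiable.differentiableOn (by fun_prop)) (hmem Y hY)
  have hga : ∀ Y ∈ ball X 1, AnalyticAt ℂ (fun s : ℂ => f (a + s • Y)) 0 := fun Y hY =>
    (hgd Y hY).analyticAt (ball_mem_nhds _ hr0)
  have hder : ∀ Y, ∀ j, 1 ≤ j → j ≤ n → iteratedDeriv j (fun s : ℂ => f (a + s • Y)) 0 = 0 := by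
    intro Y j hj1 hj2
    have := congrFun (h0 j hj1 hj2) Y
    simp only [homPart, Pi.zero_apply, div_eq_zero_iff, Nat.cast_eq_zero] at this
    exact this.resolve_right (Nat.factorial_ne_zero _)
  set M : ℝ := 2 / r ^ (n + 1) with hM
  have hM0 : 0 < M := by positivity
  -- Schwarz lemma of order `n + 1` in `s`; the radius 2 bounds the distance between two values of
  -- `f` in the unit disc.
  have hest : ∀ Y ∈ ball X 1, ∀ s ∈ ball (0 : ℂ) r,
      ‖f (a + s • Y) - f a‖ ≤ M * ‖s‖ ^ (n + 1) := by
    intro Y hY s hs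
    obtain ⟨C, hC⟩ := eventually_norm_sub_le_of_iteratedDeriv_eq_zero (hga Y hY) (hder Y)
    have := Complex.dist_le_mul_div_pow_of_mapsTo_ball_of_isLittleO (R₂ := 2) (hgd Y hY)
      (fun s hs => hdist _ (hmem Y hY s hs) _ (hmem Y hY 0 (mem_ball_self hr0)))
      (isLittleO_pow_of_norm_le hC) hs
    simp only [zero_smul, add_zero, dist_eq_norm, sub_zero] at this
    refine this.trans_eq ?_
    rw [hM, div_pow]
    ring
  -- Schwarz lemma in `Y` for fixed `s`: the direction may be perturbed at a cost of order `‖s‖ ^ (n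
  -- + 1)` times the perturbation.
  have hlip : ∀ Y ∈ ball X 1, ∀ s ∈ ball (0 : ℂ) r,
      ‖f (a + s • Y) - f (a + s • X)‖ ≤ 2 * (M * ‖s‖ ^ (n + 1)) * ‖Y - X‖ := by
    intro Y hY s hs
    have hd : DifferentiableOn ℂ (fun Y => f (a + s • Y)) (ball X 1) :=
      hf.comp (Differentiable.differentiableOn (by fun_prop)) (fun Y hY => hmem Y hY s hs)
    have := Complex.dist_le_div_mul_dist_of_mapsTo_ball (R₂ := 2 * (M * ‖s‖ ^ (n + 1))) hd ?_ hY
    · simpa [dist_eq_norm] using this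
    · intro Y' hY'
      have h1 := hest Y' hY' s hs
      have h2 := hest X (mem_ball_self one_pos) s hs
      rw [mem_closedBall, dist_eq_norm]
      calc ‖f (a + s • Y') - f (a + s • X)‖
          = ‖(f (a + s • Y') - f a) - (f (a + s • X) - f a)‖ := by congr 1; ring
        _ ≤ _ := by
          have := norm_sub_le (f (a + s • Y') - f a) (f (a + s • X) - f a)
          linarith
  have hαn : 0 < ‖α‖ := norm_pos_iff.2 hα
  -- Rescaling makes the derivative at 0 equal to `X`, on a disc of radius `1 / ‖α‖`; that radius
  -- produces the factor `‖α‖ ^ (n + 1)`.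
  set ψ : ℂ → E := fun s => φ (α * s) with hψ
  have hmaps : MapsTo (fun s => α * s) (ball (0 : ℂ) ‖α‖⁻¹) (ball 0 1) := by
    intro s hs
    rw [mem_ball_zero_iff] at hs ⊢
    rw [norm_mul]
    calc ‖α‖ * ‖s‖ < ‖α‖ * ‖α‖⁻¹ := by gcongr
      _ = 1 := mul_inv_cancel₀ hαn.ne'
  have hψD : MapsTo ψ (ball 0 ‖α‖⁻¹) D := hφ.2.comp hmaps
  have hψd : DifferentiableOn ℂ ψ (ball 0 ‖α‖⁻¹) :=
    hφ.1.comp (Differentiable.differentiableOn (by fun_prop)) hmaps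
  have hψ0 : ψ 0 = a := by simp [hψ, hφ0]
  have hψ' : HasDerivAt ψ X 0 := by
    have h1 : HasDerivAt φ (deriv φ 0) (α * 0) := by
      rw [mul_zero]
      exact (hφ.1.differentiableAt (ball_mem_nhds _ one_pos)).hasDerivAt
    have h2 : HasDerivAt (fun s : ℂ => α * s) α 0 := by
      simpa using (hasDerivAt_id (0 : ℂ)).const_mul α
    have := h1.scomp (0 : ℂ) h2
    rwa [hφ'] at this
  -- The secant direction places `ψ s` on the line through `a` in direction `Y s → X`, so `hlip`
  -- compares the disc with the straight line.
  set Y : ℂ → E := fun s => s⁻¹ • (ψ s - a) with hY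
  have hYt : Tendsto Y (𝓝[≠] 0) (𝓝 X) := by
    have := hψ'.tendsto_slope
    refine this.congr fun s => ?_
    simp [slope_def_module, hY, hψ0]
  have hψY : ∀ s, s ≠ 0 → ψ s = a + s • Y s := by
    intro s hs
    simp only [hY]
    rw [smul_inv_smul₀ hs, add_sub_cancel]
  have hev : ∀ᶠ s in 𝓝[≠] (0 : ℂ), s ∈ ball (0 : ℂ) r ∧ s ∈ ball (0 : ℂ) ‖α‖⁻¹ ∧
      Y s ∈ ball X 1 ∧ s ≠ 0 := by
    filter_upwards [nhdsWithin_le_nhds (ball_mem_nhds (0 : ℂ) hr0),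
      nhdsWithin_le_nhds (ball_mem_nhds (0 : ℂ) (inv_pos.2 hαn)),
      hYt (ball_mem_nhds _ one_pos), self_mem_nhdsWithin] with s h1 h2 h3 h4
    exact ⟨h1, h2, h3, h4⟩
  have hψO : ∀ᶠ s in 𝓝 (0 : ℂ), ‖f (ψ s) - f (ψ 0)‖ ≤ M * ‖s‖ ^ (n + 1) := by
    rw [eventually_nhdsWithin_iff] at hev
    filter_upwards [hev] with s hs
    by_cases hs0 : s = 0
    · simp [hs0]
    · obtain ⟨h1, -, h2, -⟩ := hs hs0
      rw [hψ0, hψY s hs0]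
      exact hest _ h2 _ h1
  have hψest : ∀ s ∈ ball (0 : ℂ) ‖α‖⁻¹, ‖f (ψ s) - f a‖ ≤ 2 * ‖α‖ ^ (n + 1) * ‖s‖ ^ (n + 1) := by
    intro s hs
    have := Complex.dist_le_mul_div_pow_of_mapsTo_ball_of_isLittleO (R₂ := 2)
      (f := fun s => f (ψ s)) (hf.comp hψd hψD)
      (fun s hs => hdist _ (hψD hs) _ (hψD (mem_ball_self (by positivity))))
      (isLittleO_pow_of_norm_le hψO) hs
    rw [hψ0, dist_eq_norm, dist_zero_right, div_inv_eq_mul, mul_pow] at this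
    linarith
  have hlim := (tendsto_sub_div_pow_of_iteratedDeriv_eq_zero
    (hga X (mem_ball_self one_pos)) (hder X)).norm
  have hYlim : Tendsto (fun s => 2 * ‖α‖ ^ (n + 1) + 2 * M * ‖Y s - X‖) (𝓝[≠] 0)
      (𝓝 (2 * ‖α‖ ^ (n + 1) + 2 * M * 0)) := by
    refine tendsto_const_nhds.add (tendsto_const_nhds.mul ?_)
    rw [← tendsto_iff_norm_sub_tendsto_zero]
    exact hYt
  rw [mul_zero, add_zero] at hYlim
  refine le_of_tendsto_of_tendsto hlim hYlim ?_
  filter_upwards [hev] with s ⟨h1, h2, h3, h4⟩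
  have hsn : 0 < ‖s‖ := norm_pos_iff.2 h4
  simp only [zero_smul, add_zero]
  rw [norm_div, norm_pow, div_le_iff₀ (by positivity)]
  have e1 := hψest s h2
  have e2 := hlip _ h3 s h1
  rw [← hψY s h4] at e2
  have e3 : ‖f (a + s • X) - f a‖ ≤ ‖f (ψ s) - f (a + s • X)‖ + ‖f (ψ s) - f a‖ := by
    rw [norm_sub_rev (f (ψ s)) (f (a + s • X))]
    exact norm_sub_le_norm_sub_add_norm_sub _ _ _
  nlinarith

/-- The Kobayashi metric is positive in the directions detected by lowest order terms. -/
theorem kobayashi_pos {D : Set E} (hD : IsOpen D) {a X : E} (ha : a ∈ D) {f : E → ℂ}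
    (hf : DifferentiableOn ℂ f D) (hm : MapsTo f D (ball 0 1)) (hne : lowestTerm f a X ≠ 0) :
    0 < kobayashi D a X := by
  classical
  obtain ⟨n, h0, hX⟩ : ∃ n : ℕ, (∀ j, 1 ≤ j → j ≤ n → homPart f a j = 0) ∧
      homPart f a (n + 1) X ≠ 0 := by
    unfold lowestTerm at hne
    split_ifs at hne with h
    · have h1 := (Nat.find_spec h).1
      refine ⟨Nat.find h - 1, fun j hj1 hj2 => ?_, ?_⟩
      · by_contra hj
        exact Nat.find_min h (m := j) (by omega) ⟨hj1, hj⟩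
      · rwa [Nat.sub_add_cancel h1]
    · exact absurd rfl hne
  set c := ‖homPart f a (n + 1) X‖ with hc
  have hc0 : 0 < c := norm_pos_iff.2 hX
  -- For `‖α‖ < b` one has `2 ‖α‖ ^ (n + 1) ≤ 2 ‖α‖ < c`, against `norm_homPart_le`.
  set b : ℝ := min 1 (c / 2) with hb
  have hb0 : 0 < b := by positivity
  -- Nonemptiness matters: the real infimum of the empty set is 0.
  refine lt_of_lt_of_le hb0 (le_csInf (kobayashi_set_nonempty hD ha X) ?_)
  rintro _ ⟨α, φ, hφ, hφ0, hφ', rfl⟩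
  have hα : α ≠ 0 := by
    rintro rfl
    apply hX
    rw [zero_smul] at hφ'
    simp [homPart, ← hφ', iteratedDeriv_const]
  have := norm_homPart_le hD ha hf hm h0 hα hφ hφ0 hφ'
  by_contra hlt
  push Not at hlt
  have h1 : ‖α‖ ≤ 1 := hlt.le.trans (min_le_left _ _)
  have h2 : ‖α‖ < c / 2 := hlt.trans_le (min_le_right _ _)
  have h3 : ‖α‖ ^ (n + 1) ≤ ‖α‖ := pow_le_of_le_one (norm_nonneg _) h1 (by omega)
  linarith

theorem kobayashi_nonneg (D : Set E) (a X : E) : 0 ≤ kobayashi D a X := by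
  apply Real.sInf_nonneg
  rintro _ ⟨α, φ, -, -, -, rfl⟩
  exact norm_nonneg _

theorem kobayashi_le {D : Set E} {a X : E} {α : ℂ} {φ : ℂ → E} (hφ : IsHolDisc D φ)
    (hφ0 : φ 0 = a) (hφ' : α • deriv φ 0 = X) : kobayashi D a X ≤ ‖α‖ := by
  refine csInf_le ⟨0, ?_⟩ ⟨α, φ, hφ, hφ0, hφ', rfl⟩
  rintro _ ⟨α, φ, -, -, -, rfl⟩
  exact norm_nonneg _

end General

-- The spectral ball and the characteristic coefficients

attribute [local instance] Matrix.linftyOpNormedRing Matrix.linftyOpNormedAlgebra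

/-- By Gelfand's formula some power `A ^ k` has norm below one. This persists near `A`, and `r(B) ^
k ≤ ‖B ^ k‖` converts it back. -/
theorem isOpen_Omega (n : ℕ) : IsOpen (Omega n) := by
  rcases Nat.eq_zero_or_pos n with rfl | hn
  · exact isOpen_discrete _
  have : Nonempty (Fin n) := ⟨⟨0, hn⟩⟩
  rw [isOpen_iff_mem_nhds]
  intro A hA
  have hA : spectralRadius ℂ A < 1 := hA
  have h1 := (spectrum.pow_nnnorm_pow_one_div_tendsto_nhds_spectralRadius A).eventually
    (gt_mem_nhds hA)
  obtain ⟨k, hk, hk1⟩ := (h1.and (eventually_ge_atTop 1)).exists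
  have hk2 : ‖A ^ k‖₊ < 1 := by
    by_contra hcon
    push Not at hcon
    have : (1 : ENNReal) ≤ (‖A ^ k‖₊ : ENNReal) ^ (1 / k : ℝ) :=
      ENNReal.one_le_rpow (by exact_mod_cast hcon) (by positivity)
    exact absurd hk (not_lt.2 this)
  have hev : ∀ᶠ B in 𝓝 A, ‖B ^ k‖₊ < 1 :=
    (continuous_nnnorm.comp (continuous_pow k)).continuousAt.eventually (gt_mem_nhds hk2)
  filter_upwards [hev] with B hB
  have h2 : spectralRadius ℂ B ^ k < 1 :=
    ((spectrum.spectralRadius_pow_le B k (by omega)).trans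
      (spectrum.spectralRadius_le_nnnorm _)).trans_lt (by exact_mod_cast hB)
  by_contra hcon
  exact absurd h2 (not_lt.2 (one_le_pow₀ (not_lt.1 hcon)))

theorem mem_Omega_iff {n : ℕ} {A : Mat n} :
    A ∈ Omega n ↔ ∀ z, A.charpoly.IsRoot z → ‖z‖ < 1 := by
  simp_rw [← Matrix.mem_spectrum_iff_isRoot_charpoly]
  constructor
  · intro h z hz
    have : (‖z‖₊ : ENNReal) < 1 := (le_iSup₂ (α := ENNReal) z hz).trans_lt h
    exact_mod_cast this
  · intro h
    rcases Nat.eq_zero_or_pos n with rfl | hn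
    · have : Subsingleton (Mat 0) := inferInstance
      simp [Omega, spectrum.SpectralRadius.of_subsingleton]
    · have : Nonempty (Fin n) := ⟨⟨0, hn⟩⟩
      exact spectrum.spectralRadius_lt_of_forall_lt A (r := 1) (fun z hz => h z hz)

theorem sigma_apply (n : ℕ) (A : Mat n) (k : Fin n) :
    sigma n A k = (-1) ^ ((k : ℕ) + 1) * A.charpoly.coeff (n - 1 - k) := by
  have hdeg : A.charpoly.natDegree = n := by simp [Matrix.charpoly_natDegree_eq_dim]
  have hk := k.2
  have h := Polynomial.coeff_eq_esymm_roots_of_splits (IsAlgClosed.splits A.charpoly)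
    (k := n - 1 - k) (by omega)
  have hsub : n - (n - 1 - (k : ℕ)) = k + 1 := by omega
  rw [hdeg, hsub, A.charpoly_monic.leadingCoeff, one_mul] at h
  rw [h, ← mul_assoc, ← mul_pow]
  simp [sigma]

theorem contDiff_mvPolynomial_eval {ι : Type*} [Fintype ι] (p : MvPolynomial ι ℂ) :
    ContDiff ℂ ⊤ (fun x : ι → ℂ => MvPolynomial.eval x p) := by
  induction p using MvPolynomial.induction_on with
  | C a => simpa using contDiff_const
  | add p q hp hq => simpa using hp.add hq
  | mul_X p i hp => simpa using hp.mul (contDiff_apply ℂ ℂ i)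

theorem contDiff_charpoly_coeff (n k : ℕ) :
    ContDiff ℂ ⊤ (fun A : Mat n => A.charpoly.coeff k) := by
  have h : ∀ A : Mat n, A.charpoly.coeff k =
      MvPolynomial.eval (fun p : Fin n × Fin n => A p.1 p.2)
        ((Matrix.charpoly.univ ℂ (Fin n)).coeff k) := by
    intro A
    exact (Matrix.charpoly.univ_coeff_eval₂Hom (Fin n) (RingHom.id ℂ)
      (fun p : Fin n × Fin n => A p.1 p.2) k).symm
  simp_rw [h]
  refine (contDiff_mvPolynomial_eval _).comp ?_
  refine contDiff_pi.2 fun p => ?_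
  exact (Matrix.entryLinearMap ℂ ℂ p.1 p.2).toContinuousLinearMap.contDiff

/-! ### The kernel of `σ'_A` as a trace condition -/

/-- Jacobi's formula along a line. -/
theorem hasDerivAt_det_line {n : ℕ} (N B : Mat n) :
    HasDerivAt (fun t : ℂ => (N + t • B).det) ((N.adjugate * B).trace) 0 := by
  let d : ContinuousMultilinearMap ℂ (fun _ : Fin n => Fin n → ℂ) ℂ :=
    ⟨Matrix.detRowAlternating.toMultilinearMap, Continuous.matrix_det (n := Fin n) continuous_id⟩
  have hline : ∀ N B : Fin n → Fin n → ℂ,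
      HasDerivAt (fun t : ℂ => d (N + t • B)) (d.linearDeriv N B) 0 := by
    intro N B
    have h1 : HasFDerivAt d (d.linearDeriv N) (N + (0 : ℂ) • B) := by
      rw [zero_smul, add_zero]
      exact d.hasFDerivAt N
    have h2 : HasDerivAt (fun t : ℂ => N + t • B) ((1 : ℂ) • B) 0 :=
      ((hasDerivAt_id (0 : ℂ)).smul_const B).const_add _
    rw [one_smul] at h2
    exact h1.comp_hasDerivAt (0 : ℂ) h2
  have htrace : ∀ N B : Fin n → Fin n → ℂ, d.linearDeriv N B =
      ((Matrix.of N).adjugate * Matrix.of B).trace := by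
    intro N B
    rw [ContinuousMultilinearMap.linearDeriv_apply, Matrix.trace_mul_comm]
    refine Finset.sum_congr rfl fun i _ => ?_
    change ((Matrix.of N).updateRow i (B i)).det = _
    rw [← Matrix.cramer_transpose_apply, Matrix.cramer_eq_adjugate_mulVec,
      ← Matrix.adjugate_transpose, Matrix.mulVec_transpose]
    rfl
  have h := hline N B
  rw [htrace N B] at h
  exact h

/-- The coefficients of `adj (x - A)` as a polynomial in `x`. -/
noncomputable def adjCoeff {n : ℕ} (A : Mat n) (k : ℕ) : Mat n :=
  (matPolyEquiv (Matrix.charmatrix A).adjugate).coeff k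

/-- Comparison of the coefficients of `x ^ (k + 1)` in `adj (x - A) (x - A) = charpoly(x) · 1`. -/
theorem adjCoeff_mul_self {n : ℕ} (A : Mat n) (k : ℕ) :
    adjCoeff A (k + 1) * A = adjCoeff A k - A.charpoly.coeff (k + 1) • (1 : Mat n) := by
  have h : A.charpoly • (1 : Matrix (Fin n) (Fin n) (Polynomial ℂ)) =
      (Matrix.charmatrix A).adjugate * Matrix.charmatrix A := (Matrix.adjugate_mul _).symm
  apply_fun fun p => (matPolyEquiv p).coeff (k + 1) at h
  rw [map_mul, Matrix.matPolyEquiv_charmatrix, matPolyEquiv_smul_one, mul_sub,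
    Polynomial.coeff_sub, Polynomial.coeff_mul_X, Polynomial.coeff_mul_C, Polynomial.coeff_map] at h
  rw [Algebra.algebraMap_eq_smul_one] at h
  rw [h, adjCoeff, adjCoeff]
  abel

theorem adjCoeff_zero_mul_self {n : ℕ} (A : Mat n) :
    adjCoeff A 0 * A = - A.charpoly.coeff 0 • (1 : Mat n) := by
  have h : A.charpoly • (1 : Matrix (Fin n) (Fin n) (Polynomial ℂ)) =
      (Matrix.charmatrix A).adjugate * Matrix.charmatrix A := (Matrix.adjugate_mul _).symm
  apply_fun fun p => (matPolyEquiv p).coeff 0 at h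
  rw [map_mul, Matrix.matPolyEquiv_charmatrix, matPolyEquiv_smul_one, mul_sub,
    Polynomial.coeff_sub, Polynomial.coeff_mul_X_zero, Polynomial.coeff_mul_C,
    Polynomial.coeff_map, zero_sub, Algebra.algebraMap_eq_smul_one] at h
  rw [neg_smul, h, neg_neg, adjCoeff]

/-- For `k ≥ n` the recursion has no `charpoly` term, so vanishing descends from beyond the
polynomial degree to index `n`. -/
theorem adjCoeff_eq_zero {n : ℕ} (A : Mat n) {k : ℕ} (hk : n ≤ k) : adjCoeff A k = 0 := by
  set N := (matPolyEquiv (Matrix.charmatrix A).adjugate).natDegree with hN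
  have hbig : ∀ k, N < k → adjCoeff A k = 0 := fun k hk =>
    Polynomial.coeff_eq_zero_of_natDegree_lt hk
  have hdeg : A.charpoly.natDegree = n := by simp [Matrix.charpoly_natDegree_eq_dim]
  have hstep : ∀ k, n ≤ k → adjCoeff A (k + 1) = 0 → adjCoeff A k = 0 := by
    intro k hk h
    have := adjCoeff_mul_self A k
    rw [h, zero_mul, Polynomial.coeff_eq_zero_of_natDegree_lt (by omega), zero_smul,
      sub_zero] at this
    exact this.symm
  have hall : ∀ j k, n ≤ k → N < k + j → adjCoeff A k = 0 := by
    intro j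
    induction j with
    | zero => exact fun k _ h => hbig k h
    | succ j ih => exact fun k hk h => hstep k hk (ih (k + 1) (by omega) (by omega))
  exact hall (N + 1) k hk (by omega)

theorem adjCoeff_pred {n : ℕ} (A : Mat (n + 1)) : adjCoeff A n = 1 := by
  have := adjCoeff_mul_self A n
  have hdeg : A.charpoly.natDegree = n + 1 := by simp [Matrix.charpoly_natDegree_eq_dim]
  have hc : A.charpoly.coeff (n + 1) = 1 := by
    simpa only [hdeg] using A.charpoly_monic.coeff_natDegree
  rw [adjCoeff_eq_zero A le_rfl, zero_mul, hc, one_smul] at this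
  exact (sub_eq_zero.1 this.symm)

theorem trace_adjugate_eq {n : ℕ} (A B : Mat n) (x : ℂ) :
    ((Matrix.scalar (Fin n) x - A).adjugate * B).trace =
      (((Matrix.charmatrix A).adjugate * B.map Polynomial.C).trace).eval x := by
  have h := (Polynomial.evalRingHom x).map_adjugate (Matrix.charmatrix A)
  have h2 : (Polynomial.evalRingHom x).mapMatrix (Matrix.charmatrix A) =
      Matrix.scalar (Fin n) x - A := by
    ext i j
    simp [Matrix.charmatrix_apply, Matrix.diagonal_apply, apply_ite]
  have h3 : (Polynomial.evalRingHom x).mapMatrix (B.map Polynomial.C) = B := by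
    ext i j
    simp
  rw [h2] at h
  rw [← Polynomial.coe_evalRingHom, AddMonoidHom.map_trace, ← RingHom.mapMatrix_apply,
    map_mul, h, h3]

theorem coeff_trace_adjugate_charmatrix {n : ℕ} (A B : Mat n) (k : ℕ) :
    (((Matrix.charmatrix A).adjugate * B.map Polynomial.C).trace).coeff k =
      (adjCoeff A k * B).trace := by
  simp only [Matrix.trace, Matrix.diag_apply, Matrix.mul_apply, Polynomial.finsetSum_coeff,
    Matrix.map_apply, Polynomial.coeff_mul_C, adjCoeff, matPolyEquiv_coeff_apply]

/-- The trace pairings of `B` with all `adj (x - A)` vanish if and only if those with all powers of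
`A` do. -/
theorem trace_adjugate_eq_zero_iff {n : ℕ} (A B : Mat n) :
    (∀ x : ℂ, ((Matrix.scalar (Fin n) x - A).adjugate * B).trace = 0) ↔
      ∀ k : ℕ, (A ^ k * B).trace = 0 := by
  have h1 : (∀ x : ℂ, ((Matrix.scalar (Fin n) x - A).adjugate * B).trace = 0) ↔
      ∀ k, (adjCoeff A k * B).trace = 0 := by
    simp_rw [trace_adjugate_eq, ← coeff_trace_adjugate_charmatrix]
    constructor
    · intro h k
      have h0 := Polynomial.funext (q := 0) (by simpa using h)
      rw [h0, Polynomial.coeff_zero]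
    · intro h x
      have h0 := Polynomial.ext (q := 0) (by simpa using h)
      rw [h0, Polynomial.eval_zero]
  rw [h1]
  rcases n with _ | n
  · simp [Matrix.trace]
  constructor
  · intro h
    -- All `k` are carried along in the induction on `j`: the index `n`, where the coefficient is 1,
    -- yields `tr (A ^ j B) = 0`, which removes the `charpoly` term.
    have key : ∀ j k, (adjCoeff A k * A ^ j * B).trace = 0 := by
      intro j
      induction j with
      | zero => simpa using h
      | succ j ih =>
        have hj : (A ^ j * B).trace = 0 := by simpa [adjCoeff_pred] using ih n
        intro k
        rw [pow_succ', ← mul_assoc]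
        cases k with
        | zero => rw [adjCoeff_zero_mul_self]; simp [hj]
        | succ k => rw [adjCoeff_mul_self]; simp [sub_mul, hj, ih k]
    intro k
    simpa [adjCoeff_pred] using key k n
  · intro h
    have hall : ∀ i k, n + 1 ≤ k + i → ∀ j, (adjCoeff A k * A ^ j * B).trace = 0 := by
      intro i
      induction i with
      | zero => intro k hk j; simp [adjCoeff_eq_zero A (show n + 1 ≤ k by omega)]
      | succ i ih =>
        intro k hk j
        have h2 := ih (k + 1) (by omega) (j + 1)
        rw [pow_succ', ← mul_assoc, adjCoeff_mul_self] at h2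
        simpa [sub_mul, h j] using h2
    intro k
    simpa using hall (n + 1) k (by omega) 0

theorem hasDerivAt_charpoly_coeff_line {n : ℕ} (A B : Mat n) (k : ℕ) :
    HasDerivAt (fun t : ℂ => (A + t • B).charpoly.coeff k)
      (fderiv ℂ (fun A : Mat n => A.charpoly.coeff k) A B) 0 := by
  have h1 : HasFDerivAt (fun A : Mat n => A.charpoly.coeff k)
      (fderiv ℂ (fun A : Mat n => A.charpoly.coeff k) A) (A + (0 : ℂ) • B) := by
    rw [zero_smul, add_zero]
    exact ((contDiff_charpoly_coeff n k).differentiable (by simp)).differentiableAt.hasFDerivAt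
  have h2 : HasDerivAt (fun t : ℂ => A + t • B) ((1 : ℂ) • B) 0 :=
    ((hasDerivAt_id (0 : ℂ)).smul_const B).const_add _
  rw [one_smul] at h2
  exact h1.comp_hasDerivAt (0 : ℂ) h2

/-- Two computations of the derivative of `det (x - A - t B)` at `t = 0`: coefficientwise, and by
Jacobi's formula. -/
theorem sum_fderiv_charpoly_coeff {n : ℕ} (A B : Mat n) (x : ℂ) :
    ∑ k ∈ Finset.range (n + 1), fderiv ℂ (fun A : Mat n => A.charpoly.coeff k) A B * x ^ k =
      - ((Matrix.scalar (Fin n) x - A).adjugate * B).trace := by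
  have h1 : HasDerivAt (fun t : ℂ => ∑ k ∈ Finset.range (n + 1),
      (A + t • B).charpoly.coeff k * x ^ k) (∑ k ∈ Finset.range (n + 1),
      fderiv ℂ (fun A : Mat n => A.charpoly.coeff k) A B * x ^ k) 0 :=
    HasDerivAt.fun_sum fun k _ => (hasDerivAt_charpoly_coeff_line A B k).mul_const _
  have h2 := hasDerivAt_det_line (Matrix.scalar (Fin n) x - A) (-B)
  have h3 : (fun t : ℂ => ∑ k ∈ Finset.range (n + 1), (A + t • B).charpoly.coeff k * x ^ k) =
      fun t : ℂ => (Matrix.scalar (Fin n) x - A + t • -B).det := by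
    funext t
    rw [← Polynomial.eval_eq_sum_range' (p := (A + t • B).charpoly)
      (by simp [Matrix.charpoly_natDegree_eq_dim]), Matrix.eval_charpoly]
    congr 1
    rw [smul_neg]
    abel
  rw [h3] at h1
  rw [h1.unique h2]
  simp

theorem fderiv_charpoly_coeff_self {n : ℕ} (A B : Mat n) :
    fderiv ℂ (fun A : Mat n => A.charpoly.coeff n) A B = 0 := by
  have : (fun A : Mat n => A.charpoly.coeff n) = fun _ => (1 : ℂ) := by
    funext A
    have hdeg : A.charpoly.natDegree = n := by simp [Matrix.charpoly_natDegree_eq_dim]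
    simpa only [hdeg] using A.charpoly_monic.coeff_natDegree
  rw [this]
  simp

theorem mem_kerSigma'_iff_coeff {n : ℕ} (A B : Mat n) :
    B ∈ kerSigma' A ↔ ∀ k, k < n → fderiv ℂ (fun A : Mat n => A.charpoly.coeff k) A B = 0 := by
  have hs : sigma n = fun (A : Mat n) (k : Fin n) => (-1 : ℂ) ^ ((k : ℕ) + 1) * A.charpoly.coeff (n - 1 - k) := by
    funext A k
    exact sigma_apply n A k
  have hd : ∀ k, DifferentiableAt ℂ (fun A : Mat n => A.charpoly.coeff k) A := fun k =>
    ((contDiff_charpoly_coeff n k).differentiable (by simp)).differentiableAt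
  have hcomp : ∀ k : Fin n, fderiv ℂ (sigma n) A B k =
      (-1 : ℂ) ^ ((k : ℕ) + 1) *
        fderiv ℂ (fun A : Mat n => A.charpoly.coeff (n - 1 - k)) A B := by
    intro k
    have hF : HasFDerivAt (sigma n) (ContinuousLinearMap.pi fun k : Fin n =>
        (-1 : ℂ) ^ ((k : ℕ) + 1) •
          fderiv ℂ (fun A : Mat n => A.charpoly.coeff (n - 1 - k)) A) A := by
      rw [hs]
      exact hasFDerivAt_pi.2 fun k => (hd _).hasFDerivAt.const_mul _
    rw [hF.fderiv]
    rfl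
  constructor
  · intro h k hk
    have h : fderiv ℂ (sigma n) A B = 0 := h
    have h2 := hcomp ⟨n - 1 - k, by omega⟩
    rw [h] at h2
    have h3 : n - 1 - (n - 1 - k) = k := by omega
    simp only [h3] at h2
    simpa using h2.symm
  · intro h
    change fderiv ℂ (sigma n) A B = 0
    funext k
    rw [hcomp, h _ (by have := k.2; omega), mul_zero]
    rfl

theorem mem_kerSigma'_iff_adjugate {n : ℕ} (A B : Mat n) :
    B ∈ kerSigma' A ↔ ∀ x : ℂ, ((Matrix.scalar (Fin n) x - A).adjugate * B).trace = 0 := by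
  rw [mem_kerSigma'_iff_coeff]
  constructor
  · intro h x
    have h2 := sum_fderiv_charpoly_coeff A B x
    rw [Finset.sum_eq_zero] at h2
    · exact neg_eq_zero.1 h2.symm
    · intro k hk
      rcases (Nat.lt_succ_iff.1 (Finset.mem_range.1 hk)).lt_or_eq with h3 | rfl
      · rw [h k h3, zero_mul]
      · rw [fderiv_charpoly_coeff_self, zero_mul]
  · intro h k hk
    set p : Polynomial ℂ := ∑ k ∈ Finset.range (n + 1),
      Polynomial.C (fderiv ℂ (fun A : Mat n => A.charpoly.coeff k) A B) * Polynomial.X ^ k with hp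
    have hp0 : p = 0 := by
      apply Polynomial.funext
      intro x
      have := sum_fderiv_charpoly_coeff A B x
      rw [h x, neg_zero] at this
      simpa [hp, Polynomial.eval_finsetSum] using this
    have := congrArg (fun q => Polynomial.coeff q k) hp0
    simp only [hp, Polynomial.finsetSum_coeff, Polynomial.coeff_C_mul_X_pow,
      Polynomial.coeff_zero] at this
    rw [Finset.sum_ite_eq (Finset.range (n + 1)) k, if_pos (Finset.mem_range.2 (by omega))] at this
    exact this

theorem mem_kerSigma'_iff {n : ℕ} (A B : Mat n) :
    B ∈ kerSigma' A ↔ ∀ k : ℕ, (A ^ k * B).trace = 0 := by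
  rw [mem_kerSigma'_iff_adjugate, trace_adjugate_eq_zero_iff]

/-! ### Scaled characteristic polynomials as test functions -/

theorem lowestTerm_eq_homPart {E : Type*} [AddCommGroup E] [Module ℂ E] {g : E → ℂ} {a : E} {k : ℕ}
    (hk : 1 ≤ k) (h0 : ∀ j, 1 ≤ j → j < k → homPart g a j = 0) (hne : homPart g a k ≠ 0) (X : E) :
    lowestTerm g a X = homPart g a k X := by
  classical
  have h : ∃ k : ℕ, 1 ≤ k ∧ homPart g a k ≠ 0 := ⟨k, hk, hne⟩
  have hfind : Nat.find h = k := by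
    rw [Nat.find_eq_iff]
    exact ⟨⟨hk, hne⟩, fun j hj hj2 => hj2.2 (h0 j hj2.1 hj)⟩
  unfold lowestTerm
  rw [dif_pos h]
  convert rfl using 2
  rw [← hfind]

theorem iteratedDeriv_polynomial_eval (p : Polynomial ℂ) (k : ℕ) :
    iteratedDeriv k (fun t => p.eval t) =
      fun t => ((Polynomial.derivative^[k]) p).eval t := by
  induction k with
  | zero => simp
  | succ k ih =>
    rw [iteratedDeriv_succ, ih, Function.iterate_succ_apply']
    funext t
    simp

theorem iteratedDeriv_polynomial_eval_zero_div (p : Polynomial ℂ) (k : ℕ) :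
    iteratedDeriv k (fun t => p.eval t) 0 / (k.factorial : ℂ) = p.coeff k := by
  rw [iteratedDeriv_polynomial_eval]
  beta_reduce
  rw [← Polynomial.coeff_zero_eq_eval_zero,
    Polynomial.coeff_iterate_derivative, zero_add, Nat.descFactorial_self, nsmul_eq_mul]
  have : (k.factorial : ℂ) ≠ 0 := by exact_mod_cast Nat.factorial_ne_zero _
  field_simp

/-- The value at `x` of the characteristic polynomial, scaled so that it maps the spectral ball
into the unit disc. -/
noncomputable def specFun {n : ℕ} (x : ℂ) (M : Mat n) : ℂ :=
  (((‖x‖ + 1) ^ n + 1 : ℝ) : ℂ)⁻¹ * (Matrix.scalar (Fin n) x - M).det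

theorem specFun_const_ne_zero (n : ℕ) (x : ℂ) : (((‖x‖ + 1) ^ n + 1 : ℝ) : ℂ)⁻¹ ≠ 0 := by
  have : (0 : ℝ) < (‖x‖ + 1) ^ n + 1 := by positivity
  exact inv_ne_zero (by exact_mod_cast this.ne')

theorem differentiable_specFun {n : ℕ} (x : ℂ) : Differentiable ℂ (specFun (n := n) x) := by
  have h : specFun (n := n) x = fun M : Mat n => (((‖x‖ + 1) ^ n + 1 : ℝ) : ℂ)⁻¹ *
      ∑ k ∈ Finset.range (n + 1), M.charpoly.coeff k * x ^ k := by
    funext M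
    rw [specFun, ← Matrix.eval_charpoly, Polynomial.eval_eq_sum_range' (n := n + 1)]
    simp [Matrix.charpoly_natDegree_eq_dim]
  rw [h]
  refine Differentiable.const_mul ?_ _
  refine Differentiable.fun_sum fun k _ => ?_
  exact ((contDiff_charpoly_coeff n k).differentiable (by simp)).mul_const _

theorem norm_multiset_prod_sub_le (x : ℂ) (s : Multiset ℂ) (hs : ∀ r ∈ s, ‖r‖ < 1) :
    ‖(s.map (fun r => x - r)).prod‖ ≤ (‖x‖ + 1) ^ s.card := by
  induction s using Multiset.induction_on with
  | empty => simp
  | cons r s ih =>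
    rw [Multiset.map_cons, Multiset.prod_cons, norm_mul, Multiset.card_cons, pow_succ']
    gcongr
    · have := norm_sub_le x r
      have := hs r (Multiset.mem_cons_self r s)
      linarith
    · exact ih fun r hr => hs r (Multiset.mem_cons_of_mem hr)

/-- With eigenvalues in the disc, `|det (x - M)| = ∏ |x - λ| ≤ (‖x‖ + 1) ^ n`; the extra 1 in the
scaling makes the bound strict. -/
theorem mapsTo_specFun {n : ℕ} (x : ℂ) :
    MapsTo (specFun (n := n) x) (Omega n) (Metric.ball 0 1) := by
  intro M hM
  rw [mem_Omega_iff] at hM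
  have hsp := IsAlgClosed.splits M.charpoly
  have hdeg : M.charpoly.natDegree = n := by simp [Matrix.charpoly_natDegree_eq_dim]
  have h1 := norm_multiset_prod_sub_le x M.charpoly.roots
    (fun r hr => hM r (Polynomial.isRoot_of_mem_roots hr))
  rw [← hsp.eval_eq_prod_roots_of_monic M.charpoly_monic, Polynomial.splits_iff_card_roots.1 hsp,
    hdeg, Matrix.eval_charpoly] at h1
  have hc : (0 : ℝ) < (‖x‖ + 1) ^ n + 1 := by positivity
  rw [mem_ball_zero_iff, specFun, norm_mul, norm_inv, Complex.norm_real,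
    Real.norm_of_nonneg hc.le, inv_mul_lt_iff₀ hc]
  linarith

theorem homPart_specFun_one {n : ℕ} (x : ℂ) (A B : Mat n) :
    homPart (specFun x) A 1 B = - ((((‖x‖ + 1) ^ n + 1 : ℝ) : ℂ)⁻¹ *
      ((Matrix.scalar (Fin n) x - A).adjugate * B).trace) := by
  have h := (hasDerivAt_det_line (Matrix.scalar (Fin n) x - A) (-B)).const_mul
    (((‖x‖ + 1) ^ n + 1 : ℝ) : ℂ)⁻¹
  have h2 : (fun t : ℂ => (specFun x (A + t • B) : ℂ)) = fun t : ℂ =>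
      (((‖x‖ + 1) ^ n + 1 : ℝ) : ℂ)⁻¹ * (Matrix.scalar (Fin n) x - A + t • -B).det := by
    funext t
    rw [specFun]
    congr 2
    rw [smul_neg]
    abel
  rw [homPart, iteratedDeriv_one, h2, h.deriv]
  simp

/-- If `B` has nonzero trace against some `adj (x - A)`, then `specFun x` already has a first-order
term that is nonzero at `B`. -/
theorem coneC'_subset_kerSigma' {n : ℕ} (A : Mat n) : coneC' A ⊆ kerSigma' A := by
  intro B hB
  rw [mem_kerSigma'_iff_adjugate]
  intro x
  by_contra hx
  have h1 : homPart (specFun x) A 1 B ≠ 0 := by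
    rw [homPart_specFun_one]
    exact neg_ne_zero.2 (mul_ne_zero (specFun_const_ne_zero n x) hx)
  have h2 := lowestTerm_eq_homPart le_rfl (fun j hj1 hj2 => absurd hj1 (by omega))
    (fun h => h1 (congrFun h B)) B
  rw [hB (specFun x) (differentiable_specFun x).differentiableOn (mapsTo_specFun x)] at h2
  exact h1 h2.symm

/-! ### Krylov matrices and a criterion for cyclicity -/

/-- Duality for the trace pairing. -/
theorem mem_of_forall_trace_mul_eq_zero {n : ℕ} (P : Submodule ℂ (Mat n)) (S : Mat n)
    (h : ∀ B : Mat n, (∀ X ∈ P, (X * B).trace = 0) → (S * B).trace = 0) : S ∈ P := by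
  by_contra hS
  obtain ⟨φ, hφS, hφP⟩ := Submodule.exists_le_ker_of_notMem hS
  have hrep : ∀ X : Mat n,
      φ X = (X * Matrix.of fun j i => φ (Matrix.single i j 1)).trace := by
    intro X
    conv_lhs => rw [Matrix.matrix_eq_sum_single X]
    simp only [map_sum, Matrix.trace, Matrix.diag_apply, Matrix.mul_apply, Matrix.of_apply]
    refine Finset.sum_congr rfl fun i _ => Finset.sum_congr rfl fun j _ => ?_
    rw [← smul_eq_mul, ← map_smul, Matrix.smul_single, smul_eq_mul, mul_one]
  apply hφS
  rw [hrep]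
  apply h
  intro X hX
  rw [← hrep]
  exact hφP hX

/-- The matrix with columns `v, A v, …, A ^ (n - 1) v`. -/
def krylov {n : ℕ} (A : Mat n) (v : Fin n → ℂ) : Mat n :=
  Matrix.of fun i k => (A ^ (k : ℕ)).mulVec v i

theorem isCyclicMat_iff_krylov {n : ℕ} (A : Mat n) :
    IsCyclicMat A ↔ ∃ v, (krylov A v).det ≠ 0 := by
  refine exists_congr fun v => ?_
  have h : (Set.range fun k : Fin n => (A ^ (k : ℕ)).mulVec v) = Set.range (krylov A v).col := by
    congr 1
  rw [h, ← Matrix.range_mulVecLin, LinearMap.range_eq_top, Matrix.coe_mulVecLin,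
    Matrix.mulVec_surjective_iff_isUnit, Matrix.isUnit_iff_isUnit_det, isUnit_iff_ne_zero]

/-- By Cayley–Hamilton only the remainder of `p` modulo `charpoly` matters, and it involves only the
Krylov columns. -/
theorem dotProduct_aeval_eq_zero {n : ℕ} {A : Mat n} {v w : Fin n → ℂ}
    (h : w ᵥ* (krylov A v) = 0) (p : Polynomial ℂ) :
    w ⬝ᵥ (Polynomial.aeval A p).mulVec v = 0 := by
  have hn : ∀ k, k < n → w ⬝ᵥ (A ^ k).mulVec v = 0 := fun k hk => congrFun h ⟨k, hk⟩
  have hdeg : A.charpoly.natDegree = n := by simp [Matrix.charpoly_natDegree_eq_dim]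
  rcases Nat.eq_zero_or_pos n with rfl | hpos
  · simp [dotProduct]
  rw [Matrix.aeval_eq_aeval_mod_charpoly, Polynomial.aeval_eq_sum_range' (n := n)]
  · rw [Matrix.sum_mulVec, dotProduct_sum]
    refine Finset.sum_eq_zero fun k hk => ?_
    rw [Matrix.smul_mulVec, dotProduct_smul, hn k (Finset.mem_range.1 hk), smul_zero]
  · have := Polynomial.natDegree_modByMonic_lt p A.charpoly_monic
      (fun h1 => by rw [h1, Polynomial.natDegree_one] at hdeg; omega)
    omega

/-- If all eigenspaces of `Aᵀ` have dimension at most one, then `A` is cyclic. -/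
theorem isCyclicMat_of_finrank_eigenspace_le_one {n : ℕ} (A : Mat n)
    (h : ∀ μ : ℂ, ∀ w₁ w₂ : Fin n → ℂ, w₁ ≠ 0 → w₁ ᵥ* A = μ • w₁ → w₂ ᵥ* A = μ • w₂ →
      ∃ c : ℂ, w₂ = c • w₁) : IsCyclicMat A := by
  set f : Module.End ℂ (Fin n → ℂ) := A.vecMulLinear with hf
  have hfA : ∀ w, f w = w ᵥ* A := fun w => rfl
  have hex : ∀ μ : {μ // f.HasEigenvalue μ}, ∃ w, f.HasEigenvector μ.1 w := fun μ =>
    μ.2.exists_hasEigenvector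
  choose g hg using hex
  have : Finite {μ // f.HasEigenvalue μ} := f.finite_hasEigenvalue
  -- Finitely many hyperplanes do not cover the space: `v` is chosen orthogonal to none of the left
  -- eigenvectors `g μ`.
  obtain ⟨v, hv⟩ := Module.Dual.exists_forall_ne_zero_of_forall_exists
    (fun μ : {μ // f.HasEigenvalue μ} => dotProductBilin ℂ ℂ (g μ)) (by
      intro μ
      by_contra hcon
      push Not at hcon
      apply (hg μ).2
      exact dotProduct_eq_zero _ hcon)
  rw [isCyclicMat_iff_krylov]
  refine ⟨v, fun hdet => ?_⟩
  obtain ⟨w, hw0, hw⟩ := Matrix.exists_vecMul_eq_zero_iff.2 hdet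
  -- The annihilator of the Krylov space is invariant; if nonzero, it contains a left eigenvector
  -- orthogonal to `v`, contrary to the choice of `v`.
  let W : Submodule ℂ (Fin n → ℂ) :=
    { carrier := {w | ∀ k : ℕ, w ⬝ᵥ (A ^ k).mulVec v = 0}
      add_mem' := fun {a b} ha hb k => by rw [add_dotProduct, ha k, hb k, add_zero]
      zero_mem' := fun k => zero_dotProduct _
      smul_mem' := fun c a ha k => by rw [smul_dotProduct, ha k, smul_zero] }
  have hwW : w ∈ W := fun k => by simpa using dotProduct_aeval_eq_zero hw (Polynomial.X ^ k)
  have hfW : ∀ u ∈ W, f u ∈ W := by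
    intro u hu k
    rw [hfA, ← Matrix.dotProduct_mulVec, Matrix.mulVec_mulVec, ← pow_succ']
    exact hu (k + 1)
  have : Nontrivial W := ⟨⟨⟨w, hwW⟩, 0, fun h => hw0 (congrArg Subtype.val h)⟩⟩
  obtain ⟨μ, hμ⟩ := Module.End.exists_eigenvalue (f.restrict hfW)
  obtain ⟨u, hu⟩ := hμ.exists_hasEigenvector
  have hu1 : f u = μ • (u : Fin n → ℂ) := congrArg Subtype.val hu.apply_eq_smul
  have hu0 : (u : Fin n → ℂ) ≠ 0 := fun h => hu.2 (Subtype.ext h)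
  have hμf : f.HasEigenvalue μ :=
    Module.End.hasEigenvalue_of_hasEigenvector (Module.End.hasEigenvector_iff.2
      ⟨Module.End.mem_eigenspace_iff.2 hu1, hu0⟩)
  obtain ⟨c, hc⟩ := h μ u (g ⟨μ, hμf⟩) hu0 hu1 (hg ⟨μ, hμf⟩).apply_eq_smul
  apply hv ⟨μ, hμf⟩
  have hu2 : (u : Fin n → ℂ) ⬝ᵥ v = 0 := by simpa using u.2 0
  change g ⟨μ, hμf⟩ ⬝ᵥ v = 0
  rw [hc, smul_dotProduct, hu2, smul_zero]

/-! ### Strictness of the inclusion at noncyclic matrices -/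

/-- The projection onto the coordinates where `D` vanishes. -/
noncomputable def zeroProj {n : ℕ} (D : Fin n → ℂ) : Mat n :=
  open Classical in Matrix.diagonal fun i => if D i = 0 then 1 else 0

theorem zeroProj_mul_diagonal {n : ℕ} (D : Fin n → ℂ) : zeroProj D * Matrix.diagonal D = 0 := by
  classical
  rw [zeroProj, Matrix.diagonal_mul_diagonal, ← Matrix.diagonal_zero]
  congr 1
  funext i
  by_cases h : D i = 0 <;> simp [h]

/-- A matrix whose left null space is not a line has a diagonal form with two zero entries. -/
theorem exists_diagonal_two_zeros {n : ℕ} {N : Mat n} {w₁ w₂ : Fin n → ℂ} (h0 : w₁ ≠ 0)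
    (h1 : w₁ ᵥ* N = 0) (h2 : w₂ ᵥ* N = 0) (hne : ∀ c : ℂ, w₂ ≠ c • w₁) :
    ∃ (L L' : Mat n) (D : Fin n → ℂ), L.det = 1 ∧ L'.det = 1 ∧ L * N * L' = Matrix.diagonal D ∧
      ∃ i j, i ≠ j ∧ D i = 0 ∧ D j = 0 := by
  obtain ⟨l, l', D, hD⟩ :=
    Matrix.Pivot.exists_list_transvec_mul_mul_list_transvec_eq_diagonal N
  set L := (l.map Matrix.TransvectionStruct.toMatrix).prod with hL
  set L' := (l'.map Matrix.TransvectionStruct.toMatrix).prod with hL'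
  have hdet : L.det = 1 := Matrix.TransvectionStruct.det_toMatrix_prod l
  have hdet' : L'.det = 1 := Matrix.TransvectionStruct.det_toMatrix_prod l'
  refine ⟨L, L', D, hdet, hdet', hD, ?_⟩
  have hunit : IsUnit L.det := by rw [hdet]; exact isUnit_one
  have hu : ∀ w : Fin n → ℂ, w ᵥ* N = 0 → ∀ i, (w ᵥ* L⁻¹) i * D i = 0 := by
    intro w hw i
    have h : (w ᵥ* L⁻¹) ᵥ* Matrix.diagonal D = 0 := by
      rw [← hD, Matrix.vecMul_vecMul, ← Matrix.mul_assoc, ← Matrix.mul_assoc,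
        Matrix.nonsing_inv_mul _ hunit, Matrix.one_mul, ← Matrix.vecMul_vecMul, hw,
        Matrix.zero_vecMul]
    have := congrFun h i
    rwa [Matrix.vecMul_diagonal] at this
  have hback : ∀ w : Fin n → ℂ, (w ᵥ* L⁻¹) ᵥ* L = w := by
    intro w
    rw [Matrix.vecMul_vecMul, Matrix.nonsing_inv_mul _ hunit, Matrix.vecMul_one]
  by_contra hcon
  push Not at hcon
  obtain ⟨i, hi⟩ : ∃ i, (w₁ ᵥ* L⁻¹) i ≠ 0 := by
    by_contra hall
    push Not at hall
    apply h0
    rw [← hback w₁, show w₁ ᵥ* L⁻¹ = 0 from funext hall, Matrix.zero_vecMul]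
  have hDi : D i = 0 := (mul_eq_zero.1 (hu w₁ h1 i)).resolve_left hi
  have key : w₂ ᵥ* L⁻¹ = ((w₂ ᵥ* L⁻¹) i / (w₁ ᵥ* L⁻¹) i) • (w₁ ᵥ* L⁻¹) := by
    funext k
    rw [Pi.smul_apply, smul_eq_mul]
    by_cases hk : k = i
    · subst hk
      field_simp
    · have hDk : D k ≠ 0 := fun h => hcon i k (Ne.symm hk) hDi h
      rw [(mul_eq_zero.1 (hu w₁ h1 k)).resolve_right hDk,
        (mul_eq_zero.1 (hu w₂ h2 k)).resolve_right hDk, mul_zero]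
  apply hne ((w₂ ᵥ* L⁻¹) i / (w₁ ᵥ* L⁻¹) i)
  conv_lhs => rw [← hback w₂, key, Matrix.smul_vecMul, hback]

/-- A linear condition on the block where `D` vanishes can be met by an invertible block. -/
theorem exists_trace_eq_zero_det_ne_zero {n : ℕ} (H : Mat n) (D : Fin n → ℂ)
    (hD : ∃ i j, i ≠ j ∧ D i = 0 ∧ D j = 0) :
    ∃ F : Mat n, (H * F).trace = 0 ∧ (Matrix.diagonal D + zeroProj D * F).det ≠ 0 := by
  classical
  set d : Fin n → ℂ := fun i => if D i = 0 then 1 else D i with hd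
  have hd0 : ∀ i, d i ≠ 0 := by
    intro i
    by_cases h : D i = 0 <;> simp [hd, h]
  have hdet : (Matrix.diagonal d).det ≠ 0 := by
    rw [Matrix.det_diagonal]
    exact Finset.prod_ne_zero_iff.2 fun i _ => hd0 i
  have hsplit : Matrix.diagonal D + zeroProj D = Matrix.diagonal d := by
    rw [zeroProj, Matrix.diagonal_add]
    congr 1
    funext i
    by_cases h : D i = 0 <;> simp [hd, h]
  have hidem : zeroProj D * zeroProj D = zeroProj D := by
    rw [zeroProj, Matrix.diagonal_mul_diagonal]
    congr 1
    funext i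
    by_cases h : D i = 0 <;> simp [h]
  -- If `H` has a nonzero off-diagonal entry in the block, a transvection corrects the trace of the
  -- identity block. Otherwise a fixed-point-free permutation of the block has trace zero against
  -- `H`.
  by_cases hoff : ∃ i j, i ≠ j ∧ D i = 0 ∧ D j = 0 ∧ H j i ≠ 0
  · obtain ⟨i, j, hij, hi, hj, hH⟩ := hoff
    set c : ℂ := - (H * zeroProj D).trace / H j i with hc
    refine ⟨zeroProj D + Matrix.single i j c, ?_, ?_⟩
    · rw [mul_add, Matrix.trace_add, Matrix.trace_mul_single]
      rw [hc]
      simp [MulOpposite.smul_eq_mul_unop]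
      field_simp
      ring
    · have h1 : zeroProj D * Matrix.single i j c = Matrix.diagonal d * Matrix.single i j c := by
        ext k l
        rw [zeroProj, Matrix.diagonal_mul, Matrix.diagonal_mul]
        by_cases hk : i = k
        · subst hk
          simp [hd, hi]
        · simp [Matrix.single_apply_of_row_ne hk]
      rw [mul_add, hidem, ← add_assoc, hsplit, h1]
      have h2 : Matrix.diagonal d + Matrix.diagonal d * Matrix.single i j c =
          Matrix.diagonal d * Matrix.transvection i j c := by
        rw [Matrix.transvection, mul_add, mul_one]
      rw [h2, Matrix.det_mul, Matrix.det_transvection_of_ne i j hij, mul_one]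
      exact hdet
  · push Not at hoff
    obtain ⟨i, j, hij, hi, hj⟩ := hD
    set Z : Finset (Fin n) := Finset.univ.filter fun i => D i = 0 with hZ
    -- A single cycle through `Z`; it moves every point of `Z` because `Z` has at least two
    -- elements.
    set σ : Equiv.Perm (Fin n) := Z.toList.formPerm with hσ
    have hsupp : σ.support = Z := by
      rw [hσ, List.support_formPerm_of_nodup _ Z.nodup_toList, Finset.toList_toFinset]
      intro x hx
      have hi' : i ∈ Z.toList := by simp [hZ, hi]
      have hj' : j ∈ Z.toList := by simp [hZ, hj]
      rw [hx, List.mem_singleton] at hi' hj'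
      exact hij (hi'.trans hj'.symm)
    have hmem : ∀ k, k ∈ σ.support ↔ D k = 0 := by
      intro k
      rw [hsupp]
      simp [hZ]
    have hfix : ∀ k, D k ≠ 0 → σ k = k := by
      intro k hk
      exact Equiv.Perm.notMem_support.1 fun h => hk ((hmem k).1 h)
    refine ⟨zeroProj D * σ.permMatrix ℂ, ?_, ?_⟩
    · rw [Matrix.trace]
      refine Finset.sum_eq_zero fun l _ => ?_
      rw [Matrix.diag_apply, Matrix.mul_apply]
      refine Finset.sum_eq_zero fun k _ => ?_
      rw [zeroProj, Matrix.diagonal_mul, Equiv.Perm.permMatrix, PEquiv.toMatrix_apply]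
      by_cases hk : D k = 0
      · by_cases hkl : σ k = l
        · have hk' := (hmem k).2 hk
          have hl : D l = 0 := by
            rw [← hkl, ← hmem]
            exact Equiv.Perm.apply_mem_support.2 hk'
          have hne : k ≠ l := by
            rw [← hkl]
            exact (Equiv.Perm.mem_support.1 hk').symm
          rw [hoff k l hne hk hl, zero_mul]
        · simp [hkl]
      · simp [hk]
    · have h1 : Matrix.diagonal D + zeroProj D * (zeroProj D * σ.permMatrix ℂ) =
          Matrix.diagonal d * σ.permMatrix ℂ := by
        rw [← mul_assoc, hidem, ← hsplit, add_mul]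
        congr 1
        ext k l
        rw [Matrix.diagonal_mul, Matrix.diagonal_apply, Equiv.Perm.permMatrix,
          PEquiv.toMatrix_apply]
        by_cases hk : D k = 0
        · simp [hk]
        · simp [hfix k hk]
      rw [h1, Matrix.det_mul, Matrix.det_permutation]
      refine mul_ne_zero hdet ?_
      rcases Int.units_eq_one_or (Equiv.Perm.sign σ) with h | h <;> simp [h]

/-- The polynomials in `A` annihilated by `x - A` form a space of dimension at most one. -/
theorem exists_forall_aeval_eq_smul {n : ℕ} (A : Mat n) (x : ℂ) :
    ∃ S : Mat n, ∀ p : Polynomial ℂ, Polynomial.aeval A p * (Matrix.scalar (Fin n) x - A) = 0 →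
      ∃ c : ℂ, Polynomial.aeval A p = c • S := by
  let I : Ideal (Polynomial ℂ) :=
    { carrier := {p | Polynomial.aeval A p * (Matrix.scalar (Fin n) x - A) = 0}
      add_mem' := fun {a b} ha hb => by
        have ha : _ = _ := ha
        have hb : _ = _ := hb
        change _ = _
        rw [map_add, add_mul, ha, hb, add_zero]
      zero_mem' := by change _ = _; rw [map_zero, zero_mul]
      smul_mem' := fun c p hp => by
        have hp : _ = _ := hp
        change _ = _
        rw [smul_eq_mul, map_mul, mul_assoc, hp, mul_zero] }
  set g := Submodule.IsPrincipal.generator I with hg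
  have hgI : Polynomial.aeval A g * (Matrix.scalar (Fin n) x - A) = 0 :=
    Submodule.IsPrincipal.generator_mem I
  refine ⟨Polynomial.aeval A g, fun p hp => ?_⟩
  obtain ⟨r, hr⟩ := (Submodule.IsPrincipal.mem_iff_generator_dvd I).1 (show p ∈ I from hp)
  rw [← hg] at hr
  obtain ⟨s, hs⟩ := Polynomial.X_sub_C_dvd_sub_C_eval (a := x) (p := r)
  refine ⟨r.eval x, ?_⟩
  -- Modulo `x - X` the cofactor `r` is the constant `r(x)`, and `g(A)` is killed by `x - A`.
  have hr2 : r = Polynomial.C (r.eval x) - (Polynomial.C x - Polynomial.X) * s := by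
    rw [sub_eq_iff_eq_add] at hs
    linear_combination hs
  have hx : Polynomial.aeval A (Polynomial.C x - Polynomial.X) = Matrix.scalar (Fin n) x - A := by
    simp [Algebra.algebraMap_eq_smul_one, Matrix.smul_one_eq_diagonal]
  rw [hr, map_mul]
  conv_lhs => rw [hr2]
  rw [map_sub, mul_sub, map_mul, hx, ← mul_assoc, hgI, zero_mul, sub_zero, Polynomial.aeval_C,
    Algebra.algebraMap_eq_smul_one, mul_smul_comm, mul_one]

/-- A direction in `ker σ'_A` along which `det (x - A)` vanishes to the lowest possible order. -/
theorem exists_direction {n : ℕ} (A : Mat n) (x : ℂ) {L L' : Mat n} {D : Fin n → ℂ}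
    (hL : L.det = 1) (hL' : L'.det = 1)
    (hN : L * (Matrix.scalar (Fin n) x - A) * L' = Matrix.diagonal D)
    (hD : ∃ i j, i ≠ j ∧ D i = 0 ∧ D j = 0) :
    ∃ B : Mat n, (∀ k : ℕ, (A ^ k * B).trace = 0) ∧
      (Matrix.diagonal D + zeroProj D * (L * B * L')).det ≠ 0 := by
  set N := Matrix.scalar (Fin n) x - A with hNdef
  have hLu : IsUnit L.det := by rw [hL]; exact isUnit_one
  have hLu' : IsUnit L'.det := by rw [hL']; exact isUnit_one
  obtain ⟨S₀, hS₀⟩ := exists_forall_aeval_eq_smul A x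
  obtain ⟨F, hF, hFdet⟩ := exists_trace_eq_zero_det_ne_zero (L'⁻¹ * S₀ * L⁻¹) D hD
  let T : Submodule ℂ (Mat n) :=
    { carrier := {B | ∀ k : ℕ, (A ^ k * B).trace = 0}
      add_mem' := fun {a b} ha hb k => by rw [mul_add, Matrix.trace_add, ha k, hb k, add_zero]
      zero_mem' := fun k => by simp
      smul_mem' := fun c a ha k => by rw [mul_smul_comm, Matrix.trace_smul, ha k, smul_zero] }
  let R : Submodule ℂ (Mat n) := LinearMap.range (LinearMap.mulLeft ℂ N)
  -- A functional vanishing on `T` and `R` is given by a polynomial in `A` killed by `N`, hence by a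
  -- multiple of `S₀`; `F` was chosen to be orthogonal to it. The `R`-component is harmless, since
  -- `zeroProj D` kills `diagonal D`.
  have hmem : L⁻¹ * F * L'⁻¹ ∈ T ⊔ R := by
    apply mem_of_forall_trace_mul_eq_zero
    intro S hS
    have h1 : S ∈ Subalgebra.toSubmodule (Polynomial.aeval (R := ℂ) A).range := by
      apply mem_of_forall_trace_mul_eq_zero
      intro B hB
      have hBT : B ∈ T := by
        intro k
        exact hB _ ⟨Polynomial.X ^ k, by simp⟩
      rw [Matrix.trace_mul_comm]
      exact hS B (Submodule.mem_sup_left hBT)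
    obtain ⟨p, hp⟩ := h1
    have hp : Polynomial.aeval A p = S := hp
    have h2 : S * N = 0 := by
      rw [Matrix.ext_iff_trace_mul_right]
      intro Y
      rw [zero_mul, Matrix.trace_zero, mul_assoc, Matrix.trace_mul_comm]
      exact hS (N * Y) (Submodule.mem_sup_right ⟨Y, rfl⟩)
    obtain ⟨c, hc⟩ := hS₀ p (by rw [hp]; exact h2)
    rw [← hp, hc, mul_smul_comm, Matrix.trace_smul]
    have : (L⁻¹ * F * L'⁻¹ * S₀).trace = (L'⁻¹ * S₀ * L⁻¹ * F).trace := by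
      rw [mul_assoc (L⁻¹ * F), Matrix.trace_mul_comm, ← mul_assoc]
    rw [this, hF, smul_zero]
  obtain ⟨B, hB, _, ⟨Y, rfl⟩, hsum⟩ := Submodule.mem_sup.1 hmem
  refine ⟨B, hB, ?_⟩
  have hsum : B + N * Y = L⁻¹ * F * L'⁻¹ := hsum
  have h1 : L * (B + N * Y) * L' = F := by
    rw [hsum]
    have : L * (L⁻¹ * F * L'⁻¹) * L' = (L * L⁻¹) * F * (L'⁻¹ * L') := by
      simp only [mul_assoc]
    rw [this, Matrix.mul_nonsing_inv _ hLu, Matrix.nonsing_inv_mul _ hLu', one_mul, mul_one]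
  have h2 : L * B * L' = F - Matrix.diagonal D * (L'⁻¹ * Y * L') := by
    rw [← h1, ← hN, mul_add, add_mul]
    have : L * N * L' * (L'⁻¹ * Y * L') = L * N * (L' * L'⁻¹) * Y * L' := by
      simp only [mul_assoc]
    rw [this, Matrix.mul_nonsing_inv _ hLu', mul_one, mul_assoc L N Y, add_sub_cancel_right]
  rw [h2, mul_sub, ← mul_assoc (zeroProj D), zeroProj_mul_diagonal, zero_mul, sub_zero]
  exact hFdet

/-- Factorisation of `det (N - t X)` by the power of `t` given by the corank of `N`. -/
theorem exists_det_sub_smul_eq {n : ℕ} {N L L' : Mat n} {D : Fin n → ℂ}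
    (hL : L.det = 1) (hL' : L'.det = 1) (hN : L * N * L' = Matrix.diagonal D) (X : Mat n) :
    ∃ g : Polynomial ℂ, g.coeff 0 = (Matrix.diagonal D - zeroProj D * (L * X * L')).det ∧
      ∀ t : ℂ, (N - t • X).det =
        (Polynomial.X ^ (Nat.card {i // D i = 0}) * g).eval t := by
  classical
  set M := L * X * L' with hM
  set G₀ := Matrix.diagonal D - zeroProj D * M with hG₀
  set G₁ := (1 - zeroProj D) * M with hG₁
  -- One factor `t` is pulled out of each row where `D` vanishes; what remains is `G₀ - t G₁`.
  refine ⟨(G₀.map Polynomial.C - (Polynomial.X : Polynomial ℂ) • G₁.map Polynomial.C).det,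
    ?_, fun t => ?_⟩
  · rw [Polynomial.coeff_zero_eq_eval_zero, eval_det]
    congr 1
    ext i j
    simp
  · have heval : ((G₀.map Polynomial.C - (Polynomial.X : Polynomial ℂ) •
        G₁.map Polynomial.C).det).eval t = (G₀ - t • G₁).det := by
      rw [eval_det]
      congr 1
      ext i j
      simp [mul_comm]
    have h1 : (N - t • X).det = (Matrix.diagonal D - t • M).det := by
      have : Matrix.diagonal D - t • M = L * (N - t • X) * L' := by
        rw [mul_sub, sub_mul, hN, hM, mul_smul_comm, smul_mul_assoc]
      rw [this, Matrix.det_mul, Matrix.det_mul, hL, hL', one_mul, mul_one]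
    have h2 : Matrix.diagonal D - t • M =
        Matrix.diagonal (fun i => if D i = 0 then t else 1) * (G₀ - t • G₁) := by
      ext i j
      rw [Matrix.diagonal_mul, hG₀, hG₁, zeroProj]
      by_cases h : D i = 0
      · simp [h, sub_mul, Matrix.diagonal_mul, Matrix.diagonal_apply]
      · simp [h, sub_mul, Matrix.diagonal_mul]
    rw [h1, h2, Matrix.det_mul, Matrix.det_diagonal, Polynomial.eval_mul, heval,
      Polynomial.eval_pow, Polynomial.eval_X, Finset.prod_ite]
    simp [Nat.card_eq_fintype_card, Fintype.card_subtype]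

theorem coneC'_ssubset_kerSigma' {n : ℕ} (A : Mat n) (hA : ¬ IsCyclicMat A) :
    coneC' A ⊂ kerSigma' A := by
  refine ⟨coneC'_subset_kerSigma' A, fun hsub => ?_⟩
  have hex : ∃ μ : ℂ, ∃ w₁ w₂ : Fin n → ℂ, w₁ ≠ 0 ∧ w₁ ᵥ* A = μ • w₁ ∧ w₂ ᵥ* A = μ • w₂ ∧
      ∀ c : ℂ, w₂ ≠ c • w₁ := by
    by_contra hcon
    push Not at hcon
    exact hA (isCyclicMat_of_finrank_eigenspace_le_one A fun μ w₁ w₂ h0 h1 h2 =>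
      hcon μ w₁ w₂ h0 h1 h2)
  obtain ⟨x, w₁, w₂, h0, h1, h2, hne⟩ := hex
  have hker : ∀ w : Fin n → ℂ, w ᵥ* A = x • w → w ᵥ* (Matrix.scalar (Fin n) x - A) = 0 := by
    intro w hw
    rw [Matrix.vecMul_sub, hw, Matrix.scalar_apply]
    funext i
    simp
  obtain ⟨L, L', D, hL, hL', hN, hD⟩ := exists_diagonal_two_zeros h0 (hker _ h1) (hker _ h2) hne
  obtain ⟨B, hB, hdet⟩ := exists_direction A x hL hL' hN hD
  set m := Nat.card {i // D i = 0} with hm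
  have hm1 : 1 ≤ m := by
    obtain ⟨i, -, -, hi, -⟩ := hD
    have : Nonempty {i // D i = 0} := ⟨⟨i, hi⟩⟩
    exact Nat.card_pos
  have hhom : ∀ X : Mat n, ∃ g : Polynomial ℂ,
      g.coeff 0 = (Matrix.diagonal D - zeroProj D * (L * X * L')).det ∧
      ∀ k, homPart (specFun x) A k X =
        (((‖x‖ + 1) ^ n + 1 : ℝ) : ℂ)⁻¹ * (Polynomial.X ^ m * g).coeff k := by
    intro X
    obtain ⟨g, hg0, hg⟩ := exists_det_sub_smul_eq hL hL' hN X
    refine ⟨g, hg0, fun k => ?_⟩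
    rw [← Polynomial.coeff_C_mul, ← iteratedDeriv_polynomial_eval_zero_div, homPart]
    congr 2
    funext t
    rw [specFun, Polynomial.eval_mul, Polynomial.eval_C, ← hg, sub_sub]
  have hlow : ∀ j, 1 ≤ j → j < m → homPart (specFun x) A j = 0 := by
    intro j _ hj
    funext X
    obtain ⟨g, -, hg⟩ := hhom X
    rw [hg, Polynomial.coeff_X_pow_mul', if_neg (by omega), mul_zero]
    rfl
  -- The sign compensates for `det (x - A - t X)`, turning the block condition on `B` into this
  -- coefficient.
  have hBm : homPart (specFun x) A m (-B) ≠ 0 := by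
    obtain ⟨g, hg0, hg⟩ := hhom (-B)
    rw [hg, Polynomial.coeff_X_pow_mul', if_pos le_rfl, Nat.sub_self, hg0]
    refine mul_ne_zero (specFun_const_ne_zero n x) ?_
    simpa using hdet
  have hker' : -B ∈ kerSigma' A := by
    rw [mem_kerSigma'_iff]
    intro k
    simp [hB k]
  have hz := hsub hker' (specFun x) (differentiable_specFun x).differentiableOn (mapsTo_specFun x)
  rw [lowestTerm_eq_homPart hm1 hlow (fun h => hBm (congrFun h _))] at hz
  exact hBm hz

/-! ### Companion matrices and lifting at cyclic matrices -/

/-- The coefficients of the characteristic polynomial below the leading one. -/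
noncomputable def charCoeff {n : ℕ} (A : Mat n) : Fin n → ℂ := fun k => A.charpoly.coeff k

/-- The companion matrix of `X ^ n + ∑ c i X ^ i`. -/
def companionMat {n : ℕ} (c : Fin n → ℂ) : Mat n :=
  Matrix.of fun i j => if (j : ℕ) + 1 = n then -c i else if (i : ℕ) = j + 1 then 1 else 0

/-- The first vector of the standard basis. -/
def firstVec (n : ℕ) : Fin n → ℂ := fun i => if (i : ℕ) = 0 then 1 else 0

theorem mem_Omega_congr {n : ℕ} {A B : Mat n} (h : A.charpoly = B.charpoly) :
    A ∈ Omega n ↔ B ∈ Omega n := by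
  rw [mem_Omega_iff, mem_Omega_iff, h]

theorem charpoly_eq_of_charCoeff_eq {n : ℕ} {A B : Mat n} (h : charCoeff A = charCoeff B) :
    A.charpoly = B.charpoly := by
  have hdeg : ∀ A : Mat n, A.charpoly.natDegree = n := fun A => by
    simp [Matrix.charpoly_natDegree_eq_dim]
  have hlead : ∀ A : Mat n, A.charpoly.coeff n = 1 := fun A => by
    simpa only [hdeg A] using A.charpoly_monic.coeff_natDegree
  ext k
  rcases lt_trichotomy k n with hk | rfl | hk
  · exact congrFun h ⟨k, hk⟩
  · rw [hlead, hlead]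
  · rw [Polynomial.coeff_eq_zero_of_natDegree_lt (by rw [hdeg]; exact hk),
      Polynomial.coeff_eq_zero_of_natDegree_lt (by rw [hdeg]; exact hk)]

theorem krylov_mulVec {n : ℕ} (A : Mat n) (v c : Fin n → ℂ) :
    krylov A v *ᵥ c = ∑ k : Fin n, c k • (A ^ (k : ℕ)) *ᵥ v := by
  funext i
  simp [krylov, Matrix.mulVec, dotProduct, Finset.sum_apply, mul_comm]

theorem pow_mulVec_eq_neg_krylov {n : ℕ} (A : Mat n) (v : Fin n → ℂ) :
    (A ^ n) *ᵥ v = - (krylov A v *ᵥ charCoeff A) := by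
  have hdeg : A.charpoly.natDegree = n := by simp [Matrix.charpoly_natDegree_eq_dim]
  have hlead : A.charpoly.coeff n = 1 := by
    simpa only [hdeg] using A.charpoly_monic.coeff_natDegree
  have h := A.aeval_self_charpoly
  rw [Polynomial.aeval_eq_sum_range' (n := n + 1) (by omega), Finset.sum_range_succ, hlead,
    one_smul] at h
  rw [eq_neg_iff_add_eq_zero, krylov_mulVec, add_comm]
  have h2 := congrArg (fun M : Mat n => M *ᵥ v) h
  simp only [Matrix.add_mulVec, Matrix.sum_mulVec, Matrix.zero_mulVec, Matrix.smul_mulVec] at h2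
  rw [Finset.sum_range] at h2
  exact h2

theorem companionMat_mulVec_single {n : ℕ} (c : Fin n → ℂ) (j : Fin n) :
    companionMat c *ᵥ Pi.single j 1 =
      fun i => if (j : ℕ) + 1 = n then -c i else if (i : ℕ) = j + 1 then 1 else 0 := by
  rw [Matrix.mulVec_single_one]
  rfl

theorem companionMat_pow_mulVec {n : ℕ} (c : Fin n → ℂ) {k : ℕ} (hk : k < n) :
    (companionMat c ^ k) *ᵥ firstVec n = Pi.single ⟨k, hk⟩ 1 := by
  induction k with
  | zero =>
    funext i
    simp [firstVec, Pi.single_apply, Fin.ext_iff]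
  | succ k ih =>
    rw [pow_succ', ← Matrix.mulVec_mulVec, ih (by omega), companionMat_mulVec_single]
    funext i
    rw [if_neg (by simp; omega), Pi.single_apply]
    simp [Fin.ext_iff]

theorem krylov_companionMat {n : ℕ} (c : Fin n → ℂ) :
    krylov (companionMat c) (firstVec n) = 1 := by
  ext i k
  rw [krylov, Matrix.of_apply, companionMat_pow_mulVec c k.2, Matrix.one_apply, Pi.single_apply]

theorem charCoeff_companionMat {n : ℕ} (c : Fin n → ℂ) : charCoeff (companionMat c) = c := by
  have h := pow_mulVec_eq_neg_krylov (companionMat c) (firstVec n)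
  rw [krylov_companionMat, Matrix.one_mulVec] at h
  rcases n with _ | n
  · exact Subsingleton.elim _ _
  · rw [pow_succ', ← Matrix.mulVec_mulVec, companionMat_pow_mulVec c n.lt_succ_self,
      companionMat_mulVec_single] at h
    funext i
    have := congrFun h i
    simpa using this.symm

/-- Multiplication by `A` shifts the Krylov columns, and Cayley–Hamilton expresses the image of the
last one. Where the Krylov matrix is invertible, it conjugates `A` to its companion matrix. -/
theorem mul_krylov {n : ℕ} (A : Mat n) (v : Fin n → ℂ) :
    A * krylov A v = krylov A v * companionMat (charCoeff A) := by
  apply Matrix.ext_of_mulVec_single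
  intro j
  rw [← Matrix.mulVec_mulVec, ← Matrix.mulVec_mulVec, companionMat_mulVec_single,
    Matrix.mulVec_single_one]
  have hcol : (krylov A v).col j = (A ^ (j : ℕ)) *ᵥ v := rfl
  rw [hcol, Matrix.mulVec_mulVec, ← pow_succ']
  by_cases hj : (j : ℕ) + 1 = n
  · simp only [hj, if_true]
    rw [pow_mulVec_eq_neg_krylov, ← Matrix.mulVec_neg]
    rfl
  · have hj' : (j : ℕ) + 1 < n := by omega
    have : (fun i : Fin n => if (j : ℕ) + 1 = n then -charCoeff A i else
        if (i : ℕ) = j + 1 then 1 else 0) = Pi.single ⟨(j : ℕ) + 1, hj'⟩ 1 := by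
      funext i
      rw [if_neg hj, Pi.single_apply]
      simp [Fin.ext_iff]
    rw [this, Matrix.mulVec_single_one]
    rfl

/-- The centralizer of a cyclic matrix consists of the polynomials in it. -/
theorem exists_aeval_eq_of_commute {n : ℕ} {A S : Mat n} {v : Fin n → ℂ}
    (hv : (krylov A v).det ≠ 0) (hS : A * S = S * A) :
    ∃ p : Polynomial ℂ, Polynomial.aeval A p = S := by
  have hu : IsUnit (krylov A v).det := isUnit_iff_ne_zero.2 hv
  -- Coordinates of `S v` in the Krylov basis: `p(A)` and `S` then agree at `v`, and, commuting with
  -- `A`, on all `A ^ j v`.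
  set a : Fin n → ℂ := (krylov A v)⁻¹ *ᵥ (S *ᵥ v) with ha
  have hSv : krylov A v *ᵥ a = S *ᵥ v := by
    rw [ha, Matrix.mulVec_mulVec, Matrix.mul_nonsing_inv _ hu, Matrix.one_mulVec]
  set p : Polynomial ℂ := ∑ k : Fin n, Polynomial.C (a k) * Polynomial.X ^ (k : ℕ) with hp
  have hpv : Polynomial.aeval A p *ᵥ v = S *ᵥ v := by
    rw [← hSv, krylov_mulVec, hp, map_sum, Matrix.sum_mulVec]
    refine Finset.sum_congr rfl fun k _ => ?_
    rw [map_mul, map_pow, Polynomial.aeval_X, Polynomial.aeval_C, ← Algebra.smul_def,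
      Matrix.smul_mulVec]
  refine ⟨p, ?_⟩
  have hcomm : Commute A S := hS
  have hpA : Commute A (Polynomial.aeval A p) := by
    have := Polynomial.aeval_X (R := ℂ) A
    have h2 : Commute (Polynomial.aeval A (Polynomial.X : Polynomial ℂ))
      (Polynomial.aeval A p) := (Commute.all _ _).map (Polynomial.aeval A)
    rwa [this] at h2
  have hmul : Polynomial.aeval A p * krylov A v = S * krylov A v := by
    apply Matrix.ext_of_mulVec_single
    intro j
    rw [← Matrix.mulVec_mulVec, ← Matrix.mulVec_mulVec, Matrix.mulVec_single_one]
    have hcol : (krylov A v).col j = (A ^ (j : ℕ)) *ᵥ v := rfl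
    rw [hcol, Matrix.mulVec_mulVec, Matrix.mulVec_mulVec, ← (hpA.pow_left j).eq,
      ← (hcomm.pow_left j).eq, ← Matrix.mulVec_mulVec, ← Matrix.mulVec_mulVec, hpv]
  have := congrArg (fun M => M * (krylov A v)⁻¹) hmul
  simpa only [mul_assoc, Matrix.mul_nonsing_inv _ hu, mul_one] using this

/-- For a cyclic matrix, `ker σ'_A` consists of commutators with `A`. -/
theorem exists_commutator_of_mem_kerSigma' {n : ℕ} {A B : Mat n} (hA : IsCyclicMat A)
    (hB : B ∈ kerSigma' A) : ∃ Y : Mat n, Y * A - A * Y = B := by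
  obtain ⟨v, hv⟩ := (isCyclicMat_iff_krylov A).1 hA
  rw [mem_kerSigma'_iff] at hB
  -- A matrix trace-orthogonal to all commutators with `A` commutes with `A`, so it is a polynomial
  -- in `A`, and the trace condition on `B` applies.
  have hmem : B ∈ LinearMap.range (LinearMap.mulRight ℂ A - LinearMap.mulLeft ℂ A) := by
    apply mem_of_forall_trace_mul_eq_zero
    intro S hS
    have hcomm : A * S = S * A := by
      rw [← sub_eq_zero, Matrix.ext_iff_trace_mul_left]
      intro Y
      have h : ((Y * A - A * Y) * S).trace = 0 := hS _ ⟨Y, rfl⟩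
      rw [mul_zero, Matrix.trace_zero, ← h, mul_sub, sub_mul, Matrix.trace_sub, Matrix.trace_sub,
        ← mul_assoc, ← mul_assoc, Matrix.trace_mul_comm (Y * S) A, ← mul_assoc]
    obtain ⟨p, rfl⟩ := exists_aeval_eq_of_commute hv hcomm
    rw [Matrix.trace_mul_comm, Polynomial.aeval_eq_sum_range, Finset.sum_mul, Matrix.trace_sum]
    refine Finset.sum_eq_zero fun k _ => ?_
    rw [smul_mul_assoc, Matrix.trace_smul, hB k, smul_zero]
  obtain ⟨Y, hY⟩ := hmem
  exact ⟨Y, hY⟩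

theorem companionMat_add_smul {n : ℕ} (c X : Fin n → ℂ) (ζ : ℂ) :
    companionMat (c + ζ • X) = companionMat c + ζ • (companionMat X - companionMat 0) := by
  ext i j
  simp only [companionMat, Matrix.of_apply, Matrix.add_apply, Matrix.smul_apply, Matrix.sub_apply,
    Pi.add_apply, Pi.smul_apply, smul_eq_mul, Pi.zero_apply]
  split_ifs <;> ring

theorem charpoly_conj {n : ℕ} {P Q M : Mat n} (h : P * Q = 1) :
    (P * M * Q).charpoly = M.charpoly := by
  rw [mul_assoc, Matrix.charpoly_mul_comm, mul_assoc, mul_eq_one_comm.1 h, mul_one]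

/-- The derivative of the coefficients of the characteristic polynomial. -/
noncomputable def charCoeffDeriv {n : ℕ} (A B : Mat n) : Fin n → ℂ :=
  fun k => fderiv ℂ (fun A : Mat n => A.charpoly.coeff k) A B

/-- Lifting of affine discs from the symmetrized polydisc through a cyclic matrix. -/
theorem scfpSolvable_of_isCyclicMat {n : ℕ} {A T : Mat n} (hA : IsCyclicMat A)
    (h : ∀ ζ ∈ Metric.ball (0 : ℂ) 1,
      companionMat (charCoeff A + ζ • charCoeffDeriv A T) ∈ Omega n) : SCFPSolvable A T := by
  obtain ⟨v, hv⟩ := (isCyclicMat_iff_krylov A).1 hA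
  set K := krylov A v with hK
  have hu : IsUnit K.det := isUnit_iff_ne_zero.2 hv
  have hKK : K * K⁻¹ = 1 := Matrix.mul_nonsing_inv _ hu
  set X := charCoeffDeriv A T with hX
  -- Along `A + ζ B₀` the characteristic coefficients move affinely with velocity `X`, so `T - B₀`
  -- lies in `ker σ'_A`.
  set B₀ : Mat n := K * (companionMat X - companionMat 0) * K⁻¹ with hB₀
  have hline : ∀ ζ : ℂ, A + ζ • B₀ = K * companionMat (charCoeff A + ζ • X) * K⁻¹ := by
    intro ζ
    rw [companionMat_add_smul, mul_add, add_mul, ← mul_krylov, mul_assoc A, hKK, mul_one,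
      mul_smul_comm, smul_mul_assoc, hB₀]
  have hchar : ∀ ζ : ℂ, (A + ζ • B₀).charpoly =
      (companionMat (charCoeff A + ζ • X)).charpoly := fun ζ => by
    rw [hline, charpoly_conj hKK]
  have hker : T - B₀ ∈ kerSigma' A := by
    rw [mem_kerSigma'_iff_coeff]
    intro k hk
    have h1 := hasDerivAt_charpoly_coeff_line A B₀ k
    have h2 : (fun t : ℂ => (A + t • B₀).charpoly.coeff k) =
        fun t : ℂ => charCoeff A ⟨k, hk⟩ + t * X ⟨k, hk⟩ := by
      funext t
      rw [hchar]
      exact congrFun (charCoeff_companionMat (charCoeff A + t • X)) ⟨k, hk⟩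
    have h3 : HasDerivAt (fun t : ℂ => charCoeff A ⟨k, hk⟩ + t * X ⟨k, hk⟩)
        (1 * X ⟨k, hk⟩) 0 := ((hasDerivAt_id (0 : ℂ)).mul_const _).const_add _
    rw [h2] at h1
    rw [map_sub, h1.unique h3, one_mul, sub_eq_zero]
    rfl
  obtain ⟨Y, hY⟩ := exists_commutator_of_mem_kerSigma' hA hker
  have hexp : ∀ ζ : ℂ, NormedSpace.exp (ζ • Y) * NormedSpace.exp (ζ • -Y) = 1 := by
    intro ζ
    rw [smul_neg, Matrix.exp_neg]
    exact Matrix.mul_nonsing_inv _ ((Matrix.isUnit_iff_isUnit_det _).1 (Matrix.isUnit_exp _))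
  -- Conjugation preserves the characteristic polynomial and adds the commutator `Y A - A Y = T -
  -- B₀` to the derivative at 0.
  set F : ℂ → Mat n := fun ζ =>
    NormedSpace.exp (ζ • Y) * (A + ζ • B₀) * NormedSpace.exp (ζ • -Y) with hF
  have hderiv : ∀ ζ : ℂ, HasDerivAt F
      ((NormedSpace.exp (ζ • Y) * Y * (A + ζ • B₀) + NormedSpace.exp (ζ • Y) * B₀) *
        NormedSpace.exp (ζ • -Y) + NormedSpace.exp (ζ • Y) * (A + ζ • B₀) *
          (NormedSpace.exp (ζ • -Y) * -Y)) ζ := by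
    intro ζ
    have h1 : HasDerivAt (fun t : ℂ => A + t • B₀) B₀ ζ := by
      have := ((hasDerivAt_id ζ).smul_const B₀).const_add A
      rwa [one_smul] at this
    exact ((hasDerivAt_exp_smul_const Y ζ).mul h1).mul (hasDerivAt_exp_smul_const (-Y) ζ)
  refine ⟨F, ⟨fun ζ _ => (hderiv ζ).differentiableAt.differentiableWithinAt, fun ζ hζ => ?_⟩,
    by simp [hF], ?_⟩
  · have : (F ζ).charpoly = (companionMat (charCoeff A + ζ • X)).charpoly := by
      rw [hF, ← hchar]
      exact charpoly_conj (hexp ζ)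
    rw [mem_Omega_congr this]
    exact h ζ hζ
  · refine (hderiv 0).deriv.trans ?_
    simp only [zero_smul, NormedSpace.exp_zero, one_mul, mul_one, add_zero]
    rw [mul_neg, ← sub_eq_add_neg, add_sub_right_comm, hY, sub_add_cancel]

/-! ### Passage to the limit along cyclic matrices -/

theorem continuous_charCoeff (n : ℕ) : Continuous (charCoeff (n := n)) :=
  continuous_pi fun k => (contDiff_charpoly_coeff n k).continuous

theorem continuous_charCoeffDeriv {n : ℕ} (T : Mat n) :
    Continuous fun A : Mat n => charCoeffDeriv A T :=
  continuous_pi fun k =>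
    ((contDiff_charpoly_coeff n k).continuous_fderiv (by simp)).clm_apply continuous_const

theorem continuous_companionMat (n : ℕ) : Continuous (companionMat (n := n)) := by
  refine continuous_matrix fun i j => ?_
  simp only [companionMat, Matrix.of_apply]
  split_ifs
  · exact (continuous_apply i).neg
  · exact continuous_const
  · exact continuous_const

/-- Data in `ker σ'_A` become solvable at all cyclic matrices near `A`. -/
theorem eventually_scfpSolvable {n : ℕ} {A T : Mat n} (hA : A ∈ Omega n) (hT : T ∈ kerSigma' A) :
    ∀ᶠ A' in 𝓝[cyclicSet n] A, SCFPSolvable A' T := by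
  have hU : {c : Fin n → ℂ | companionMat c ∈ Omega n} ∈ 𝓝 (charCoeff A) := by
    refine ((isOpen_Omega n).preimage (continuous_companionMat n)).mem_nhds ?_
    exact (mem_Omega_congr (charpoly_eq_of_charCoeff_eq
      (charCoeff_companionMat (charCoeff A)))).2 hA
  obtain ⟨ε, hε, hball⟩ := Metric.mem_nhds_iff.1 hU
  -- The velocity vanishes at `A`, hence is below `ε / 2` nearby; the other `ε / 2` absorbs the
  -- shift of the centre.
  have hT0 : charCoeffDeriv A T = 0 := by
    funext k
    exact (mem_kerSigma'_iff_coeff A T).1 hT k k.2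
  have h1 : ∀ᶠ A' in 𝓝 A, ‖charCoeff A' - charCoeff A‖ < ε / 2 := by
    have := (continuous_charCoeff n).continuousAt (x := A) (Metric.ball_mem_nhds _ (half_pos hε))
    filter_upwards [this] with A' hA'
    rwa [← dist_eq_norm]
  have h2 : ∀ᶠ A' in 𝓝 A, ‖charCoeffDeriv A' T‖ < ε / 2 := by
    have := (continuous_charCoeffDeriv T).continuousAt (x := A)
      (Metric.ball_mem_nhds _ (half_pos hε))
    filter_upwards [this] with A' hA'
    rw [mem_preimage, hT0, mem_ball_zero_iff] at hA'
    exact hA'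
  filter_upwards [nhdsWithin_le_nhds h1, nhdsWithin_le_nhds h2, self_mem_nhdsWithin]
    with A' hA1 hA2 hA3
  refine scfpSolvable_of_isCyclicMat hA3.2 fun ζ hζ => hball ?_
  rw [mem_ball_zero_iff] at hζ
  rw [mem_ball_iff_norm, add_sub_right_comm]
  calc ‖charCoeff A' - charCoeff A + ζ • charCoeffDeriv A' T‖
      ≤ ‖charCoeff A' - charCoeff A‖ + ‖ζ • charCoeffDeriv A' T‖ := norm_add_le _ _
    _ ≤ ‖charCoeff A' - charCoeff A‖ + 1 * ‖charCoeffDeriv A' T‖ := by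
        rw [norm_smul]
        gcongr
    _ < ε := by linarith

/-- Cyclic matrices are dense in the spectral ball. -/
theorem neBot_nhdsWithin_cyclicSet {n : ℕ} {A : Mat n} (hA : A ∈ Omega n) :
    (𝓝[cyclicSet n] A).NeBot := by
  -- The line joins `A` to a companion matrix, where the Krylov determinant is 1; this entire
  -- function of `s` therefore has no zeros in a punctured neighbourhood of 0.
  set γ : ℂ → Mat n := fun s => A + s • (companionMat 0 - A) with hγ
  have hγd : Differentiable ℂ γ := by
    intro s
    exact ((differentiableAt_id.smul_const _).const_add _)
  set f : ℂ → ℂ := fun s => (krylov (γ s) (firstVec n)).det with hf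
  have hfd : Differentiable ℂ f := by
    have hentry : ∀ i j : Fin n, Differentiable ℂ fun s => krylov (γ s) (firstVec n) i j := by
      intro i j
      have h1 : Differentiable ℂ fun s => γ s ^ (j : ℕ) := hγd.pow _
      simp only [krylov, Matrix.of_apply, Matrix.mulVec, dotProduct]
      refine Differentiable.fun_sum fun l _ => Differentiable.mul_const ?_ _
      exact (Matrix.entryLinearMap ℂ ℂ i l).toContinuousLinearMap.differentiable.comp h1
    rw [hf]
    simp only [Matrix.det_apply]
    refine Differentiable.fun_sum fun σ _ => Differentiable.const_smul ?_ _
    exact Differentiable.fun_finsetProd fun i _ => hentry _ _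
  have hf1 : f 1 = 1 := by
    simp [hf, hγ, krylov_companionMat]
  have hev : ∀ᶠ s in 𝓝[≠] (0 : ℂ), f s ≠ 0 := by
    by_contra hcon
    rw [Filter.not_eventually] at hcon
    simp only [not_not] at hcon
    have := (hfd.differentiableOn.analyticOnNhd
      isOpen_univ).eqOn_zero_of_preconnected_of_frequently_eq_zero isPreconnected_univ
      (mem_univ 0) hcon (mem_univ 1)
    rw [hf1] at this
    exact one_ne_zero this
  have hγ0 : Tendsto γ (𝓝 0) (𝓝 A) := by
    have := hγd.continuous.tendsto 0
    simpa [hγ] using this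
  have ht : Tendsto γ (𝓝[≠] 0) (𝓝[cyclicSet n] A) := by
    rw [tendsto_nhdsWithin_iff]
    refine ⟨hγ0.mono_left nhdsWithin_le_nhds, ?_⟩
    filter_upwards [hev, nhdsWithin_le_nhds (hγ0.eventually ((isOpen_Omega n).mem_nhds hA))]
      with s hs1 hs2
    exact ⟨hs2, (isCyclicMat_iff_krylov _).2 ⟨_, hs1⟩⟩
  exact ht.neBot

theorem smul_mem_kerSigma' {n : ℕ} {A B : Mat n} (hB : B ∈ kerSigma' A) (t : ℂ) :
    t • B ∈ kerSigma' A := by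
  rw [mem_kerSigma'_iff] at hB ⊢
  intro k
  rw [mul_smul_comm, Matrix.trace_smul, hB k, smul_zero]

theorem kobayashi_pos_of_notMem_coneC' {n : ℕ} {A B : Mat n} (hA : A ∈ Omega n)
    (hB : B ∉ coneC' A) : 0 < kobayashi (Omega n) A B := by
  have hB : ¬ ∀ f : Mat n → ℂ, DifferentiableOn ℂ f (Omega n) →
    MapsTo f (Omega n) (Metric.ball 0 1) → lowestTerm f A B = 0 := hB
  push Not at hB
  obtain ⟨f, hf, hm, hne⟩ := hB
  exact kobayashi_pos (isOpen_Omega n) hA hf hm hne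

/-- A solution for the data `(A, t B)` bounds the Kobayashi metric by `1 / t`. -/
theorem kobayashi_le_of_scfpSolvable {n : ℕ} {A B : Mat n} {t : ℝ} (ht : 0 < t)
    (h : SCFPSolvable A ((t : ℂ) • B)) : kobayashi (Omega n) A B ≤ t⁻¹ := by
  obtain ⟨F, hF, hF0, hF'⟩ := h
  have ht' : (t : ℂ) ≠ 0 := by exact_mod_cast ht.ne'
  have h1 : ((t : ℂ)⁻¹) • deriv F 0 = B := by
    rw [hF', inv_smul_smul₀ ht']
  have h2 := kobayashi_le hF hF0 h1
  rwa [norm_inv, Complex.norm_real, Real.norm_of_nonneg ht.le] at h2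

theorem not_scfpSolvable_of_one_lt {n : ℕ} {A B : Mat n} {t : ℝ}
    (ht : 1 < t * kobayashi (Omega n) A B) : ¬ SCFPSolvable A ((t : ℂ) • B) := by
  intro h
  have h0 : 0 ≤ kobayashi (Omega n) A B := kobayashi_nonneg _ _ _
  have ht0 : 0 < t := by
    by_contra hcon
    have := mul_nonpos_of_nonpos_of_nonneg (not_lt.1 hcon) h0
    linarith
  have h1 := mul_le_mul_of_nonneg_left (kobayashi_le_of_scfpSolvable ht0 h) ht0.le
  rw [mul_inv_cancel₀ ht0.ne'] at h1
  linarith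

/-- The Kobayashi metric tends to zero along cyclic matrices in directions of `ker σ'_A`. -/
theorem tendsto_kobayashi_cyclicSet {n : ℕ} {A B : Mat n} (hA : A ∈ Omega n)
    (hB : B ∈ kerSigma' A) :
    Tendsto (fun A' => kobayashi (Omega n) A' B) (𝓝[cyclicSet n] A) (𝓝 0) := by
  rw [Metric.tendsto_nhds]
  intro ε hε
  -- Solvability for `(2 / ε) B` gives the bound `ε / 2`.
  filter_upwards [eventually_scfpSolvable hA (smul_mem_kerSigma' hB (((2 / ε : ℝ)) : ℂ))]
    with A' hA'
  have h1 := kobayashi_le_of_scfpSolvable (by positivity) hA'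
  have h0 : 0 ≤ kobayashi (Omega n) A' B := kobayashi_nonneg _ _ _
  rw [Real.dist_eq, sub_zero, abs_of_nonneg h0]
  rw [inv_div] at h1
  linarith

end SpectralBall

theorem mainTheorem10 (n : ℕ) (A : SpectralBall.Mat n) (hA : A ∈ SpectralBall.Omega n)
    (hAc : ¬ SpectralBall.IsCyclicMat A) :
    -- the cone is strictly smaller than the kernel
    SpectralBall.coneC' A ⊂ SpectralBall.kerSigma' A ∧
    -- `A` is a limit of cyclic matrices, so that the limits below are genuine
    (𝓝[SpectralBall.cyclicSet n] A).NeBot ∧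
    ∀ B ∈ SpectralBall.kerSigma' A \ SpectralBall.coneC' A,
      0 < SpectralBall.kobayashi (SpectralBall.Omega n) A B ∧
      Tendsto (fun A' => SpectralBall.kobayashi (SpectralBall.Omega n) A' B)
        (𝓝[SpectralBall.cyclicSet n] A) (𝓝 0) ∧
      -- the Kobayashi metric is discontinuous in its first variable at `A`
      ¬ ContinuousWithinAt (fun A' => SpectralBall.kobayashi (SpectralBall.Omega n) A' B)
        (SpectralBall.Omega n) A ∧
      -- the problem is discontinuous in the data: it is not solvable at `(A, t B)`,
      -- but it is solvable at `(A', t B)` for all cyclic `A'` close to `A`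
      ∀ t : ℝ, 1 < t * SpectralBall.kobayashi (SpectralBall.Omega n) A B →
        ¬ SpectralBall.SCFPSolvable A ((t : ℂ) • B) ∧
        ∀ᶠ A' in 𝓝[SpectralBall.cyclicSet n] A,
          SpectralBall.SCFPSolvable A' ((t : ℂ) • B) := by
  have hsub := SpectralBall.coneC'_ssubset_kerSigma' A hAc
  have hne := SpectralBall.neBot_nhdsWithin_cyclicSet hA
  refine ⟨hsub, hne, ?_⟩
  rintro B ⟨hB, hBc⟩
  have hpos := SpectralBall.kobayashi_pos_of_notMem_coneC' hA hBc
  have hlim := SpectralBall.tendsto_kobayashi_cyclicSet hA hB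
  refine ⟨hpos, hlim, fun hcont => ?_, fun t ht => ⟨?_, ?_⟩⟩
  · have h1 := hcont.mono_left (nhdsWithin_mono A fun A' (hA' : A' ∈ SpectralBall.cyclicSet n) => hA'.1)
    exact hpos.ne (tendsto_nhds_unique hlim h1)
  · exact SpectralBall.not_scfpSolvable_of_one_lt ht
  · exact SpectralBall.eventually_scfpSolvable hA (SpectralBall.smul_mem_kerSigma' hB _)
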